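/- Let $d\ge 2$, $k\ge 2$ be integers and $T>0$. Let $\rho_0:\mathbb R^d\to[0,1]$ be four times differentiable with bounded fourth derivative. For $n\in\{1,2,\dots\}$ let $\nu^n$ be the product measure on $\{0,1\}^{\mathbb Z^d}$ under which $\eta(x)=1$ with probability $\rho_0(x/n)$, and let $(\eta_t)_{t\ge 0}$ be the symmetric simple exclusion process with initial law $\nu^n$ and generator $n^2L$, where, on local functions $f$, $$L f(\eta)=\sum_{x\in\mathbb Z^d}\sum_{j=1}^d\big(f(\eta^{x,x+e_j})-f(\eta)\big)$$ and $\eta^{x,y}$ is $\eta$ with the values at $x$ and $y$ exchanged. Let $\mathbb E^n$ denote expectation for this process, put $\rho^n_t(x)=\mathbb E^n[\eta_t(x)]$, and $$\varphi_t(x_1,\dots,x_k)=\mathbb E^n\Big[\prod_{i=1}^k\big(\eta_t(x_i)-\rho^n_t(x_i)\big)\Big].$$ There is a constant $C$, depending only on $d$, $k$, $\rho_0$ and $T$, such that for all $n\ge 1$, all $0\le t\le T$ and all distinct sites $x_1,\dots,x_k\in\mathbb Z^d$ the following hold, with $\ell=\log(1+n^2t)$. 1. If $d\ge 3$, then $|\varphi_t(x_1,\dots,x_k)|\le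 C n^{-k}$. 2. If $d=2$, then $|\varphi_t(x_1,\dots,x_k)|\le C n^{-k}\max\{\ell^{\,k-1},\ell^{\lceil k/2\rceil}\}$; in particular the bound is $Cn^{-k}\log^{k-1}(1+n^2t)$ whenever $k\le 3$ or $\log(1+n^2t)\ge 1$. 3. If $d=2$ and $k$ is even, then $|\varphi_t(x_1,\dots,x_k)|\le C n^{-k}\,\ell^{\,k/2}$. 4. If $d=2$ and $k$ is odd, then $|\varphi_t(x_1,\dots,x_k)|\le C n^{-k}\,\ell^{\,(k-1)/2}\,\log(1+\ell)$. -/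

import Mathlib

open MeasureTheory ProbabilityTheory Filter Topology Set
open scoped NNReal

noncomputable section

namespace SSEP

/-- Sites of the lattice `ℤ^d`. -/
abbrev Site (d : ℕ) : Type := Fin d → ℤ

/-- The state space `{0,1}^{ℤ^d}` with its product topology and product `σ`-algebra;
`true` stands for an occupied site and `false` for an empty one. -/
abbrev Config (d : ℕ) : Type := Site d → Bool

/-- The occupation number `η(x) ∈ {0,1}`, as a real number. -/
def occ {d : ℕ} (η : Config d) (x : Site d) : ℝ := if η x then 1 else 0

/-- The configuration `η^{x,y}`: the values at `x` and `y` are exchanged. -/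
def swap {d : ℕ} (η : Config d) (x y : Site d) : Config d := fun z => η (Equiv.swap x y z)

/-- `f` is a local function: it depends on finitely many coordinates only. -/
def IsLocal {d : ℕ} (f : Config d → ℝ) : Prop := ∃ S : Finset (Site d), DependsOn f (S : Set (Site d))

/-- The generator of the symmetric simple exclusion process,
`L f (η) = ∑_x ∑_j (f(η^{x,x+e_j}) - f(η))`.
For a local function only finitely many `x` contribute to the sum. -/
def gen {d : ℕ} (f : Config d → ℝ) (η : Config d) : ℝ :=
  ∑' x : Site d, ∑ j : Fin d, (f (swap η x (x + Pi.single j 1)) - f η)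

/-- Right-continuous with left limits. -/
def IsCadlag {E : Type*} [TopologicalSpace E] (w : ℝ≥0 → E) : Prop :=
  ∀ t, ContinuousWithinAt w (Ici t) t ∧ ∃ l, Tendsto w (𝓝[<] t) (𝓝 l)

/-- The path space `D([0,∞); {0,1}^{ℤ^d})`. It carries the `σ`-algebra generated by the
coordinate maps `w ↦ w t`. -/
abbrev Path (d : ℕ) : Type := {w : ℝ≥0 → Config d // IsCadlag w}

/-- The coordinate process `η_t`. -/
def coord {d : ℕ} (t : ℝ≥0) (w : Path d) : Config d := w.1 t

theorem measurable_coord {d : ℕ} (t : ℝ≥0) : Measurable (coord (d := d) t) :=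
  (measurable_pi_apply t).comp measurable_subtype_coe

/-- The filtration generated by the coordinate process. -/
def canonicalFiltration (d : ℕ) :
    Filtration ℝ≥0 (inferInstance : MeasurableSpace (Path d)) :=
  Filtration.natural (β := fun _ => Config d) (fun t => coord t)
    (fun t => (measurable_coord t).stronglyMeasurable)

/-- Dynkin's process `f(η_t) - f(η_0) - ∫_0^t n² L f(η_s) ds`. -/
def dynkin {d : ℕ} (n : ℕ) (f : Config d → ℝ) (t : ℝ≥0) (w : Path d) : ℝ :=
  f (coord t w) - f (coord 0 w) - ∫ s in (0 : ℝ)..t, (n : ℝ) ^ 2 * gen f (coord s.toNNReal w)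

/-- `P` is the law on path space of the symmetric simple exclusion process with generator
`n² L` and initial distribution `ν`, i.e. the solution of the martingale problem for
`n² L` on local functions, started from `ν`. -/
structure IsLaw {d : ℕ} (n : ℕ) (ν : Measure (Config d)) (P : Measure (Path d)) : Prop where
  isProbabilityMeasure : IsProbabilityMeasure P
  initial : P.map (coord 0) = ν
  martingale : ∀ f : Config d → ℝ, IsLocal f → Martingale (dynkin n f) (canonicalFiltration d) P

/-- The macroscopic point `x / n ∈ ℝ^d`. -/
def rescale {d : ℕ} (n : ℕ) (x : Site d) : EuclideanSpace ℝ (Fin d) :=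
  WithLp.toLp 2 fun i => (x i : ℝ) / n

/-- The product Bernoulli measure with slowly varying profile `ρ₀`: the coordinates are
independent and `x` is occupied with probability `ρ₀(x/n)`. -/
def initialMeasure {d : ℕ} (ρ₀ : EuclideanSpace ℝ (Fin d) → unitInterval) (n : ℕ) :
    Measure (Config d) :=
  Measure.infinitePi fun x : Site d => bernoulliMeasure true false (ρ₀ (rescale n x))

/-- The mean occupation number `ρ^n_t(x) = E[η_t(x)]`. -/
def density {d : ℕ} (P : Measure (Path d)) (t : ℝ≥0) (x : Site d) : ℝ :=
  ∫ w, occ (coord t w) x ∂P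

/-- The centred correlation function
`φ(t_1,…,t_k; x_1,…,x_k) = E[∏_i (η_{t_i}(x_i) - ρ^n_{t_i}(x_i))]`. -/
def correlation {d k : ℕ} (P : Measure (Path d)) (t : Fin k → ℝ≥0) (x : Fin k → Site d) : ℝ :=
  ∫ w, ∏ i, (occ (coord (t i) w) (x i) - density P (t i) (x i)) ∂P

/-- `f` is four times differentiable and its fourth derivative is bounded. -/
def HasBoundedFourthDeriv {E : Type*} [NormedAddCommGroup E] [NormedSpace ℝ E]
    (f : E → ℝ) : Prop :=
  ContDiff ℝ 3 f ∧ Differentiable ℝ (iteratedFDeriv ℝ 3 f) ∧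
    ∃ K : ℝ, ∀ u, ‖iteratedFDeriv ℝ 4 f u‖ ≤ K

end SSEP

end

set_option linter.unusedSectionVars false

namespace SSEP

/-! ### Maximum principle and Duhamel's formula for bounded sub-Markovian generators. -/

section Comparison

variable {X : Type*}

/-! In microscopic time `s = n²t` the one-time laws solve the forward equation of `L`. The centred
correlation of the labels in `A`, viewed as a function of an injective labelled tuple, solves `∂ₛ
corr = stir corr + source` (`IsFlow.corr_ode`). Recentring cancels everything in the source except
the edges whose two endpoints carry labels `i, j ∈ A`. With `δ` the density increment along it, such
an edge contributes `2δ (corr(A∖j) - corr(A∖i)) - δ² corr(A∖{i,j})` (`edgeTerm_of_exchange`,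
`abs_source_le`). The density solves the discrete heat equation, so its increments stay `O(1/n)`
(`IsFlow.gradient_le`). Correlations vanish at time 0, hence Duhamel bounds them by the size of the
source times the expected time a pair of stirring particles spends adjacent up to `N = n²t`. By heat
kernel bounds this time is `O(α)`, with `α = 1` for `d ≥ 3` and `α = log(1+N)` for `d = 2`.

The sharp power comes from the differences `corr(A∪a) - corr(A∪b)` at adjacent `a, b`. They are
antisymmetric under exchanging the two labels, so the exchange of `a` and `b` can be replaced by
killing (`killed`). In `d = 2` a pair started adjacent survives for time `s` with probability
`O(1/log s)` (`killed_flow_le`). Combined with the heat kernel decay `1/s`, the expected adjacency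
time drops to `β = log(1+log(1+N))` (`potentialBound_two`); for `d ≥ 3` one takes `β = 1`.

Since `β² ≤ α`, a joint induction on `m` (`corr_bounds`) bounds `m`-point correlations by `n^{-m}
α^{⌊m/2⌋} β^{m mod 2}`, and differences of `(m+1)`-point correlations by `n^{-(m+1)}` times the same
power of logarithms, that is, without the growth that the extra point would bring. The four claims
are read off from this. -/

/-- `A + Λ` is positive and maps constants `M ≥ 0` below `Λ M`: `A` generates a positive
sub-Markovian semigroup with total jump rate at most `Λ`. -/
def IsSubMarkov (Λ : ℝ) (A : (X → ℝ) →ₗ[ℝ] (X → ℝ)) : Prop :=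
  0 ≤ Λ ∧ ∀ (f : X → ℝ) (M : ℝ), 0 ≤ M → (∀ y, f y ≤ M) → ∀ x, A f x + Λ * f x ≤ Λ * M

/-- The supremum need not be attained, so the maximum principle is proved by iteration. Multiplying
by `e^{Λs}` leaves only the positive part `A + Λ`; feeding an upper bound back into the equation and
integrating turns `(Λs)^n/n!` into `(Λs)^{n+1}/(n+1)!`, which tends to 0. Only upper bounds are
used, so killing is allowed. -/
theorem comparison {Λ : ℝ} {A : (X → ℝ) →ₗ[ℝ] (X → ℝ)} (hA : IsSubMarkov Λ A)
    {u u' : ℝ → X → ℝ} {T : ℝ}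
    (hu : ∀ x, ∀ s ∈ Icc 0 T, HasDerivWithinAt (fun s => u s x) (u' s x) (Ici 0) s)
    (hb : ∃ B, ∀ s ∈ Icc 0 T, ∀ x, u s x ≤ B)
    (h0 : ∀ x, u 0 x ≤ 0)
    (hle : ∀ s ∈ Icc 0 T, ∀ x, u' s x ≤ A (u s) x) :
    ∀ s ∈ Icc 0 T, ∀ x, u s x ≤ 0 := by
  obtain ⟨hΛ, hA⟩ := hA
  obtain ⟨B, hB⟩ := hb
  have key : ∀ n : ℕ, ∀ s ∈ Icc 0 T, ∀ x,
      Real.exp (Λ * s) * u s x ≤ Real.exp (Λ * T) * |B| * ((Λ * s) ^ n / n.factorial) := by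
    intro n
    induction n with
    | zero =>
      intro s hs x
      have h1 : Real.exp (Λ * s) ≤ Real.exp (Λ * T) :=
        Real.exp_le_exp.2 (mul_le_mul_of_nonneg_left hs.2 hΛ)
      calc Real.exp (Λ * s) * u s x ≤ Real.exp (Λ * s) * |B| :=
            mul_le_mul_of_nonneg_left ((hB s hs x).trans (le_abs_self B)) (Real.exp_pos _).le
        _ ≤ Real.exp (Λ * T) * |B| := mul_le_mul_of_nonneg_right h1 (abs_nonneg _)
        _ = _ := by simp
    | succ n ih =>
      intro s hs x
      have hder : ∀ r ∈ Icc 0 T, HasDerivWithinAt (fun s => Real.exp (Λ * s) * u s x)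
          (Real.exp (Λ * r) * Λ * u r x + Real.exp (Λ * r) * u' r x) (Ici 0) r := by
        intro r hr
        have h1 : HasDerivAt (fun s => Real.exp (Λ * s)) (Real.exp (Λ * r) * Λ) r := by
          simpa using ((hasDerivAt_id r).const_mul Λ).exp
        exact h1.hasDerivWithinAt.mul (hu x r hr)
      have hder2 : ∀ r, HasDerivAt
          (fun s => Real.exp (Λ * T) * |B| * ((Λ * s) ^ (n + 1) / (n + 1).factorial))
          (Real.exp (Λ * T) * |B| * (Λ * ((Λ * r) ^ n / n.factorial))) r := by
        intro r
        have h1 : HasDerivAt (fun s => (Λ * s) ^ (n + 1)) (((n + 1 : ℕ) : ℝ) * (Λ * r) ^ n * Λ) r := by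
          simpa using ((hasDerivAt_id r).const_mul Λ).fun_pow (n + 1)
        refine ((h1.div_const ((n + 1).factorial : ℝ)).const_mul
          (Real.exp (Λ * T) * |B|)).congr_deriv ?_
        rw [Nat.factorial_succ]
        have : (n.factorial : ℝ) ≠ 0 := by positivity
        push_cast
        field_simp
      refine image_le_of_deriv_right_le_deriv_boundary (a := 0) (b := T)
        (f := fun s => Real.exp (Λ * s) * u s x)
        (fun r hr => ((hder r hr).mono Icc_subset_Ici_self).continuousWithinAt)
        (fun r hr => (hder r (Ico_subset_Icc_self hr)).mono (Ici_subset_Ici.2 hr.1))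
        (B := fun s => Real.exp (Λ * T) * |B| * ((Λ * s) ^ (n + 1) / (n + 1).factorial)) ?_
        (fun r hr => (hder2 r).continuousAt.continuousWithinAt)
        (fun r hr => (hder2 r).hasDerivWithinAt) ?_ hs
      · simpa using h0 x
      · intro r hr
        have hr' := Ico_subset_Icc_self hr
        set M := Real.exp (-(Λ * r)) * (Real.exp (Λ * T) * |B| * ((Λ * r) ^ n / n.factorial))
          with hM
        have hrn : 0 ≤ Λ * r := mul_nonneg hΛ hr.1
        have hM0 : 0 ≤ M := by positivity
        have hEM : Real.exp (Λ * r) * M =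
            Real.exp (Λ * T) * |B| * ((Λ * r) ^ n / n.factorial) := by
          rw [hM, ← mul_assoc, ← Real.exp_add]; simp
        have h1 : ∀ y, u r y ≤ M := by
          intro y
          have := ih r hr' y
          rw [← hEM] at this
          exact le_of_mul_le_mul_left this (Real.exp_pos _)
        have h2 := hA (u r) M hM0 h1 x
        have h3 := hle r hr' x
        calc Real.exp (Λ * r) * Λ * u r x + Real.exp (Λ * r) * u' r x
            = Real.exp (Λ * r) * (u' r x + Λ * u r x) := by ring
          _ ≤ Real.exp (Λ * r) * (Λ * M) :=
              mul_le_mul_of_nonneg_left (by linarith) (Real.exp_pos _).le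
          _ = Λ * (Real.exp (Λ * r) * M) := by ring
          _ = _ := by rw [hEM]; ring
  intro s hs x
  have hlim : Tendsto (fun n : ℕ => Real.exp (Λ * T) * |B| * ((Λ * s) ^ n / n.factorial)) atTop
      (𝓝 (Real.exp (Λ * T) * |B| * 0)) :=
    (FloorSemiring.tendsto_pow_div_factorial_atTop (Λ * s)).const_mul _
  have h1 : Real.exp (Λ * s) * u s x ≤ 0 := by
    have := ge_of_tendsto' hlim fun n => key n s hs x
    simpa using this
  exact nonpos_of_mul_nonpos_right h1 (Real.exp_pos _)

theorem IsSubMarkov.abs_apply_le {Λ : ℝ} {A : (X → ℝ) →ₗ[ℝ] (X → ℝ)} (hA : IsSubMarkov Λ A)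
    {f : X → ℝ} {M : ℝ} (hf : ∀ y, |f y| ≤ M) (x : X) : |A f x| ≤ 2 * Λ * M := by
  have hM : 0 ≤ M := (abs_nonneg _).trans (hf x)
  have h1 := hA.2 f M hM (fun y => (abs_le.1 (hf y)).2) x
  have h2 := hA.2 (-f) M hM (fun y => by have := (abs_le.1 (hf y)).1; simp; linarith) x
  have h3 := abs_le.1 (hf x)
  simp only [map_neg, Pi.neg_apply] at h2
  rw [abs_le]
  constructor <;> nlinarith [hA.1]

/-- `W = exp(sL) f` and `H = ∫₀ˢ W`; integrating `W' = L W` gives the last identity, which turns `H'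
= W` into the inhomogeneous equation `H' = L H + f`. -/
theorem exists_linear_flow {E : Type*} [NormedAddCommGroup E] [NormedSpace ℝ E] [CompleteSpace E]
    (L : E →L[ℝ] E) (f : E) :
    ∃ W H : ℝ → E, W 0 = f ∧ H 0 = 0 ∧ (∀ s, HasDerivAt W (L (W s)) s) ∧
      (∀ s, HasDerivAt H (W s) s) ∧ ∀ s, L (H s) + f = W s := by
  let W : ℝ → E := fun s => NormedSpace.exp (s • L) f
  have hW : ∀ s, HasDerivAt W (L (W s)) s := fun s => by
    have h := hasDerivAt_exp_smul_const' (𝕂 := ℝ) L s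
    exact ((ContinuousLinearMap.apply ℝ E f).hasFDerivAt.comp_hasDerivAt s h)
  have hWc : Continuous W := continuous_iff_continuousAt.2 fun s => (hW s).continuousAt
  have hH : ∀ s, HasDerivAt (fun s => ∫ r in (0 : ℝ)..s, W r) (W s) s := fun s =>
    intervalIntegral.integral_hasDerivAt_right (hWc.intervalIntegrable _ _)
      (hWc.stronglyMeasurableAtFilter _ _) hWc.continuousAt
  have hW0 : W 0 = f := by simp [W]
  refine ⟨W, fun s => ∫ r in (0 : ℝ)..s, W r, hW0, by simp, hW, hH, fun s => ?_⟩
  have h1 : L (∫ r in (0 : ℝ)..s, W r) = ∫ r in (0 : ℝ)..s, L (W r) :=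
    (L.intervalIntegral_comp_comm (hWc.intervalIntegrable _ _)).symm
  rw [h1, intervalIntegral.integral_eq_sub_of_hasDerivAt (fun r _ => hW r)
    ((L.continuous.comp hWc).intervalIntegrable _ _), hW0]
  abel

/-- For a bounded sub-Markovian generator `A` and a bounded `f`, the solution `w` of
`w' = A w`, `w 0 = f` and its time integral `H`. -/
theorem exists_potential {Λ : ℝ} {A : (X → ℝ) →ₗ[ℝ] (X → ℝ)} (hA : IsSubMarkov Λ A)
    {f : X → ℝ} {M : ℝ} (hf : ∀ y, |f y| ≤ M) :
    ∃ w H : ℝ → X → ℝ, w 0 = f ∧ H 0 = 0 ∧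
      (∀ s x, HasDerivAt (fun s => w s x) (A (w s) x) s) ∧
      (∀ s x, HasDerivAt (fun s => H s x) (A (H s) x + f x) s) ∧
      (∀ s x, HasDerivAt (fun s => H s x) (w s x) s) ∧
      ∀ T, ∃ B, ∀ s ∈ Icc 0 T, ∀ x, |w s x| ≤ B ∧ |H s x| ≤ B := by
  -- With the discrete topology, bounded functions on `X` form a Banach space on which `A` acts with
  -- norm at most `2Λ`.
  let _ : TopologicalSpace X := ⊥
  have : DiscreteTopology X := ⟨rfl⟩
  let A₀ : BoundedContinuousFunction X ℝ →ₗ[ℝ] BoundedContinuousFunction X ℝ :=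
    { toFun := fun g => BoundedContinuousFunction.ofNormedAddCommGroupDiscrete (A g)
        (2 * Λ * ‖g‖) (fun x => hA.abs_apply_le (fun y => g.norm_coe_le_norm y) x)
      map_add' := fun g h => by
        ext x
        change A (⇑(g + h)) x = A g x + A h x
        rw [BoundedContinuousFunction.coe_add, map_add, Pi.add_apply]
      map_smul' := fun c g => by
        ext x
        change A (⇑(c • g)) x = c • A g x
        rw [BoundedContinuousFunction.coe_smul]
        change A (c • ⇑g) x = _
        rw [map_smul, Pi.smul_apply] }
  let L : BoundedContinuousFunction X ℝ →L[ℝ] BoundedContinuousFunction X ℝ := A₀.mkContinuous (2 * Λ) (fun g => by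
    have h2 : 0 ≤ 2 * Λ * ‖g‖ := mul_nonneg (mul_nonneg zero_le_two hA.1) (norm_nonneg _)
    exact (BoundedContinuousFunction.norm_le h2).2
      fun x => hA.abs_apply_le (fun y => g.norm_coe_le_norm y) x)
  let f₀ : BoundedContinuousFunction X ℝ := BoundedContinuousFunction.ofNormedAddCommGroupDiscrete f M hf
  obtain ⟨W, H, hW0, hH0, hW, hH, hLH⟩ := exists_linear_flow L f₀
  have hWc : Continuous W := continuous_iff_continuousAt.2 fun s => (hW s).continuousAt
  have hev : ∀ (F : ℝ → BoundedContinuousFunction X ℝ) F' s (x : X), HasDerivAt F F' s →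
      HasDerivAt (fun s => F s x) (F' x) s := fun F F' s x h =>
    ((BoundedContinuousFunction.evalCLM (α := X) (β := ℝ) ℝ x).hasFDerivAt.comp_hasDerivAt s h)
  refine ⟨fun s x => W s x, fun s x => H s x, ?_, ?_, ?_, ?_, ?_, ?_⟩
  · funext x; change W 0 x = f x; rw [hW0]; rfl
  · funext x; simp [hH0]
  · intro s x; exact hev W _ s x (hW s)
  · intro s x
    have h2 : W s x = A (fun x => H s x) x + f x := by
      rw [← hLH s]; rfl
    rw [← h2]; exact hev H _ s x (hH s)
  · intro s x; exact hev H _ s x (hH s)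
  · intro T
    have hHc : Continuous H := continuous_iff_continuousAt.2 fun s => (hH s).continuousAt
    obtain ⟨B₁, h1⟩ := isCompact_Icc.exists_bound_of_continuousOn (s := Icc (0 : ℝ) T)
      hWc.continuousOn
    obtain ⟨B₂, h2⟩ := isCompact_Icc.exists_bound_of_continuousOn (s := Icc (0 : ℝ) T)
      hHc.continuousOn
    refine ⟨max B₁ B₂, fun s hs x => ⟨?_, ?_⟩⟩
    · exact ((W s).norm_coe_le_norm x).trans ((h1 s hs).trans (le_max_left _ _))
    · exact ((H s).norm_coe_le_norm x).trans ((h2 s hs).trans (le_max_right _ _))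

/-- Duhamel's bound: the solution of an inhomogeneous equation with zero initial value and
a source below `b ∑ f_p` is below `b ∑ H_p`, with `H_p` the potential of `f_p`. -/
theorem duhamel_bound {Λ : ℝ} {A : (X → ℝ) →ₗ[ℝ] (X → ℝ)} (hA : IsSubMarkov Λ A)
    {κ : Type*} (J : Finset κ) (f : κ → X → ℝ) (H : κ → ℝ → X → ℝ) {b N : ℝ}
    (hH0 : ∀ p, H p 0 = 0)
    (hH : ∀ p s x, HasDerivAt (fun s => H p s x) (A (H p s) x + f p x) s)
    (hHb : ∀ p T, ∃ B, ∀ s ∈ Icc 0 T, ∀ x, |H p s x| ≤ B)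
    {u src : ℝ → X → ℝ}
    (hu : ∀ x, ∀ s ∈ Icc 0 N, HasDerivWithinAt (fun s => u s x) (A (u s) x + src s x) (Ici 0) s)
    (hub : ∃ B, ∀ s ∈ Icc 0 N, ∀ x, |u s x| ≤ B)
    (hu0 : ∀ x, u 0 x = 0)
    (hsrc : ∀ s ∈ Icc 0 N, ∀ x, |src s x| ≤ b * ∑ p ∈ J, f p x) :
    ∀ s ∈ Icc 0 N, ∀ x, |u s x| ≤ b * ∑ p ∈ J, H p s x := by
  obtain ⟨B, hB⟩ := hub
  choose BH hBH using fun p => hHb p N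
  -- The signs `ε = 1` and `ε = -1` give the two halves of the absolute value.
  have main : ∀ ε : ℝ, |ε| = 1 → ∀ s ∈ Icc 0 N, ∀ x : X, ε * u s x - b * ∑ p ∈ J, H p s x ≤ 0 := by
    intro ε hε
    refine comparison hA (u' := fun s x => ε * (A (u s) x + src s x) -
      b * ∑ p ∈ J, (A (H p s) x + f p x)) ?_ ?_ ?_ ?_
    · intro x s hs
      refine ((hu x s hs).const_mul ε).sub (HasDerivWithinAt.const_mul b ?_)
      exact HasDerivWithinAt.fun_sum fun p _ => (hH p s x).hasDerivWithinAt
    · refine ⟨B + |b| * ∑ p ∈ J, BH p, fun s hs x => ?_⟩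
      have h1 : ε * u s x ≤ B := by
        calc ε * u s x ≤ |ε * u s x| := le_abs_self _
          _ = |u s x| := by rw [abs_mul, hε, one_mul]
          _ ≤ B := hB s hs x
      have h2 : |b * ∑ p ∈ J, H p s x| ≤ |b| * ∑ p ∈ J, BH p := by
        rw [abs_mul]
        exact mul_le_mul_of_nonneg_left ((Finset.abs_sum_le_sum_abs _ _).trans
          (Finset.sum_le_sum fun p _ => hBH p s hs x)) (abs_nonneg _)
      have := (abs_le.1 h2).1
      linarith
    · intro x; simp [hu0, hH0]
    · intro s hs x
      have e : (fun x => ε * u s x - b * ∑ p ∈ J, H p s x) =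
          ε • u s - b • ∑ p ∈ J, H p s := by
        funext y; simp
      rw [e, map_sub, map_smul, map_smul, map_sum]
      have h1 : ε * src s x ≤ b * ∑ p ∈ J, f p x := by
        calc ε * src s x ≤ |ε * src s x| := le_abs_self _
          _ = |src s x| := by rw [abs_mul, hε, one_mul]
          _ ≤ _ := hsrc s hs x
      simp only [Pi.sub_apply, Pi.smul_apply, smul_eq_mul, Finset.sum_apply,
        Finset.sum_add_distrib]
      linarith
  intro s hs x
  rw [abs_le]
  have h1 := main 1 (by simp) s hs x
  have h2 := main (-1) (by simp) s hs x
  constructor <;> linarith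

theorem le_of_deriv_le {f f' g g' : ℝ → ℝ} {T : ℝ} (hf : ∀ s ∈ Icc 0 T, HasDerivAt f (f' s) s)
    (hg : ∀ s ∈ Icc 0 T, HasDerivAt g (g' s) s) (h0 : f 0 ≤ g 0)
    (h : ∀ s ∈ Icc 0 T, f' s ≤ g' s) : ∀ s ∈ Icc 0 T, f s ≤ g s := fun s hs =>
  image_le_of_deriv_right_le_deriv_boundary (a := 0) (b := T) (f := f)
    (fun r hr => (hf r hr).continuousAt.continuousWithinAt)
    (fun r hr => (hf r (Ico_subset_Icc_self hr)).hasDerivWithinAt) h0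
    (fun r hr => (hg r hr).continuousAt.continuousWithinAt)
    (fun r hr => (hg r (Ico_subset_Icc_self hr)).hasDerivWithinAt)
    (fun r hr => h r (Ico_subset_Icc_self hr)) hs

end Comparison

/-! ### Heat kernels on `ℤ` and `ℤ^d` through Fourier integrals. -/

section Kernel

/-- The solution on `ℤ` of `∂_s q = 2 Δ q` whose initial value has Fourier transform `g`. -/
noncomputable def kern (g : ℝ → ℝ) (s : ℝ) (m : ℤ) : ℝ :=
  (2 * Real.pi)⁻¹ * ∫ θ in (-Real.pi)..Real.pi,
    g θ * Real.cos (m * θ) * Real.exp (-4 * s * (1 - Real.cos θ))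

variable {g : ℝ → ℝ}

theorem intervalIntegrable_kern (hg : Continuous g) (s : ℝ) (m : ℤ) :
    IntervalIntegrable (fun θ => g θ * Real.cos (m * θ) * Real.exp (-4 * s * (1 - Real.cos θ)))
      volume (-Real.pi) Real.pi := by
  apply Continuous.intervalIntegrable
  fun_prop

/-- The symbol `-4(1 - cos θ)` is that of `2Δ`, because `cos((m+1)θ) + cos((m-1)θ) = 2 cos θ
cos(mθ)`. The factor 2 is the rate for the difference of two particles. -/
theorem kern_hasDerivAt (hg : Continuous g) (s : ℝ) (m : ℤ) :
    HasDerivAt (fun s => kern g s m)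
      (2 * (kern g s (m + 1) + kern g s (m - 1) - 2 * kern g s m)) s := by
  have hcont : Continuous fun p : ℝ × ℝ =>
      g p.2 * Real.cos (m * p.2) * (Real.exp (-4 * p.1 * (1 - Real.cos p.2)) *
        (-4 * (1 - Real.cos p.2))) := by fun_prop
  obtain ⟨B, hB⟩ := (isCompact_Icc (a := s - 1) (b := s + 1)).prod
    (isCompact_Icc (a := -Real.pi) (b := Real.pi)) |>.exists_bound_of_continuousOn
      hcont.continuousOn
  have h := (intervalIntegral.hasDerivAt_integral_of_dominated_loc_of_deriv_le
    (μ := volume) (a := -Real.pi) (b := Real.pi) (x₀ := s)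
    (F := fun s θ => g θ * Real.cos (m * θ) * Real.exp (-4 * s * (1 - Real.cos θ)))
    (F' := fun s θ => g θ * Real.cos (m * θ) * (Real.exp (-4 * s * (1 - Real.cos θ)) *
        (-4 * (1 - Real.cos θ)))) (bound := fun _ => B) (Icc_mem_nhds (by linarith : s - 1 < s)
        (by linarith : s < s + 1))
    (Eventually.of_forall fun r => Continuous.aestronglyMeasurable (by fun_prop))
    (intervalIntegrable_kern hg s m)
    (Continuous.aestronglyMeasurable (by fun_prop))
    (Eventually.of_forall fun θ hθ r hr => hB (r, θ) ⟨hr, by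
      rw [uIoc_of_le (by linarith [Real.pi_pos])] at hθ
      exact Ioc_subset_Icc_self hθ⟩)
    (by simp)
    (Eventually.of_forall fun θ hθ r hr => by
      have h1 : HasDerivAt (fun s => -4 * s * (1 - Real.cos θ)) (-4 * (1 - Real.cos θ)) r := by
        simpa using ((hasDerivAt_id r).const_mul (-4)).mul_const (1 - Real.cos θ)
      exact h1.exp.const_mul _)).2
  refine (h.const_mul (2 * Real.pi)⁻¹).congr_deriv ?_
  have i1 := intervalIntegrable_kern hg s (m + 1)
  have i2 := intervalIntegrable_kern hg s (m - 1)
  have i3 := intervalIntegrable_kern hg s m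
  unfold kern
  have : ∫ θ in (-Real.pi)..Real.pi, g θ * Real.cos (m * θ) *
        (Real.exp (-4 * s * (1 - Real.cos θ)) * (-4 * (1 - Real.cos θ))) =
      2 * ((∫ θ in (-Real.pi)..Real.pi,
        g θ * Real.cos ((m + 1 : ℤ) * θ) * Real.exp (-4 * s * (1 - Real.cos θ))) +
      (∫ θ in (-Real.pi)..Real.pi,
        g θ * Real.cos ((m - 1 : ℤ) * θ) * Real.exp (-4 * s * (1 - Real.cos θ))) -
      2 * ∫ θ in (-Real.pi)..Real.pi,
        g θ * Real.cos (m * θ) * Real.exp (-4 * s * (1 - Real.cos θ))) := by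
    rw [← intervalIntegral.integral_const_mul, ← intervalIntegral.integral_add i1 i2,
      ← intervalIntegral.integral_sub (i1.add i2) (i3.const_mul 2),
      ← intervalIntegral.integral_const_mul]
    congr 1
    funext θ
    push_cast
    rw [add_mul, sub_mul, one_mul, Real.cos_add, Real.cos_sub]
    ring
  rw [this]
  ring

theorem kern_neg (g : ℝ → ℝ) (s : ℝ) (m : ℤ) : kern g s (-m) = kern g s m := by
  simp [kern]

theorem abs_kern_le (hg : Continuous g) (hg0 : ∀ θ, 0 ≤ g θ) (s : ℝ) (m : ℤ) :
    |kern g s m| ≤ kern g s 0 := by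
  unfold kern
  rw [abs_mul, abs_of_nonneg (by positivity : (0 : ℝ) ≤ (2 * Real.pi)⁻¹)]
  refine mul_le_mul_of_nonneg_left ?_ (by positivity)
  refine (intervalIntegral.abs_integral_le_integral_abs (by linarith [Real.pi_pos])).trans ?_
  refine intervalIntegral.integral_mono_on (by linarith [Real.pi_pos])
    (intervalIntegrable_kern hg s m).abs (intervalIntegrable_kern hg s 0) fun θ _ => ?_
  rw [abs_mul, abs_mul, abs_of_nonneg (hg0 θ), abs_of_pos (Real.exp_pos _)]
  refine mul_le_mul_of_nonneg_right ?_ (Real.exp_pos _).le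
  refine mul_le_mul_of_nonneg_left ?_ (hg0 θ)
  simpa using Real.abs_cos_le_one _

theorem kern_zero_le (hg : Continuous g) (hg2 : ∀ θ, g θ ≤ 2) {s : ℝ} (hs : 0 ≤ s) :
    kern g s 0 ≤ Real.exp 8 / √(1 + s) := by
  have hπ := Real.pi_pos
  set b : ℝ := 8 * (1 + s) / Real.pi ^ 2 with hb
  have hb0 : 0 < b := by positivity
  have h1 : ∫ θ in (-Real.pi)..Real.pi,
      g θ * Real.cos ((0 : ℤ) * θ) * Real.exp (-4 * s * (1 - Real.cos θ)) ≤
      ∫ θ in (-Real.pi)..Real.pi, 2 * Real.exp 8 * Real.exp (-b * θ ^ 2) := by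
    refine intervalIntegral.integral_mono_on (by linarith)
      (intervalIntegrable_kern hg s 0) (Continuous.intervalIntegrable (by fun_prop) _ _)
      fun θ hθ => ?_
    -- From `1 - cos θ ≥ 2θ²/π²` the exponent is at most `-8sθ²/π²`. Replacing `s` by `1 + s` costs
    -- `8θ²/π² ≤ 8`, the source of `exp 8`; it makes the bound uniform down to `s = 0`.
    have hc := Real.cos_le_one_sub_mul_cos_sq (abs_le.2 hθ)
    have h2 : Real.exp (-4 * s * (1 - Real.cos θ)) ≤ Real.exp 8 * Real.exp (-b * θ ^ 2) := by
      rw [← Real.exp_add]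
      refine Real.exp_le_exp.2 ?_
      have hθ2 : θ ^ 2 ≤ Real.pi ^ 2 := by
        rw [← sq_abs]; exact pow_le_pow_left₀ (abs_nonneg _) (abs_le.2 hθ) 2
      have h3 : -4 * s * (1 - Real.cos θ) ≤ -4 * s * (2 / Real.pi ^ 2 * θ ^ 2) := by
        nlinarith
      have h4 : 8 / Real.pi ^ 2 * θ ^ 2 ≤ 8 := by
        rw [div_mul_eq_mul_div, div_le_iff₀ (by positivity)]; linarith
      have h5 : -4 * s * (2 / Real.pi ^ 2 * θ ^ 2) = 8 / Real.pi ^ 2 * θ ^ 2 + -b * θ ^ 2 := by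
        rw [hb]; ring
      linarith
    have hE : 0 ≤ Real.exp (-4 * s * (1 - Real.cos θ)) := (Real.exp_pos _).le
    calc g θ * Real.cos ((0 : ℤ) * θ) * Real.exp (-4 * s * (1 - Real.cos θ))
        = g θ * Real.exp (-4 * s * (1 - Real.cos θ)) := by simp
      _ ≤ 2 * Real.exp (-4 * s * (1 - Real.cos θ)) := mul_le_mul_of_nonneg_right (hg2 θ) hE
      _ ≤ _ := by rw [mul_assoc 2]; exact mul_le_mul_of_nonneg_left h2 zero_le_two
  have h2 : ∫ θ in (-Real.pi)..Real.pi, Real.exp (-b * θ ^ 2) ≤ √(Real.pi / b) := by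
    rw [intervalIntegral.integral_of_le (by linarith), ← integral_gaussian b]
    exact setIntegral_le_integral (integrable_exp_neg_mul_sq hb0)
      (Eventually.of_forall fun θ => (Real.exp_pos _).le)
  rw [intervalIntegral.integral_const_mul] at h1
  have h3 : √(Real.pi / b) ≤ Real.pi / √(1 + s) := by
    rw [Real.sqrt_le_left (by positivity), div_pow, Real.sq_sqrt (by linarith), hb,
      div_div_eq_mul_div, div_le_div_iff₀ (by positivity) (by linarith)]
    have : Real.pi ≤ 4 := Real.pi_le_four
    have : Real.pi * Real.pi ^ 2 ≤ 4 * Real.pi ^ 2 := by gcongr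
    nlinarith [Real.pi_pos, sq_nonneg Real.pi, mul_nonneg hs (sq_nonneg Real.pi)]
  unfold kern
  calc _ ≤ (2 * Real.pi)⁻¹ * (2 * Real.exp 8 * (Real.pi / √(1 + s))) := by
        refine mul_le_mul_of_nonneg_left (h1.trans ?_) (by positivity)
        exact mul_le_mul_of_nonneg_left (h2.trans h3) (by positivity)
    _ = _ := by field_simp

/-- On `|θ| ≤ 1/√(1+s)` the exponent `4s(1 - cos θ) ≤ 2sθ²` is at most 2, and the rest of the
integrand is nonnegative. -/
theorem le_kern_one_zero {s : ℝ} (hs : 0 ≤ s) :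
    Real.exp (-2) / Real.pi / √(1 + s) ≤ kern (fun _ => 1) s 0 := by
  have hπ := Real.pi_pos
  have hπ3 := Real.pi_gt_three
  set r : ℝ := 1 / √(1 + s) with hr
  have hsq : 1 ≤ √(1 + s) := by rw [Real.one_le_sqrt]; linarith
  have hr0 : 0 < r := by positivity
  have hr1 : r ≤ 1 := by rw [hr, div_le_one (by positivity)]; exact hsq
  have hr2 : (1 + s) * r ^ 2 = 1 := by
    rw [hr, div_pow, Real.sq_sqrt (by linarith)]; field_simp
  have hi := intervalIntegrable_kern (g := fun _ => 1) continuous_const s 0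
  have h1 : ∫ θ in (-r)..r, Real.exp (-2) ≤ ∫ θ in (-Real.pi)..Real.pi,
      1 * Real.cos ((0 : ℤ) * θ) * Real.exp (-4 * s * (1 - Real.cos θ)) := by
    refine le_trans (intervalIntegral.integral_mono_on (by linarith) (by simp)
      (hi.mono_set ?_) fun θ hθ => ?_) (intervalIntegral.integral_mono_interval
        (by linarith) (by linarith) (by linarith) (Eventually.of_forall fun θ => ?_) hi)
    · rw [uIcc_of_le (by linarith), uIcc_of_le (by linarith)]
      exact Icc_subset_Icc (by linarith) (by linarith)
    · have hc := Real.one_sub_sq_div_two_le_cos (x := θ)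
      have hθ2 : θ ^ 2 ≤ r ^ 2 := by
        rw [← sq_abs]; exact pow_le_pow_left₀ (abs_nonneg _) (abs_le.2 hθ) 2
      simp only [Int.cast_zero, zero_mul, Real.cos_zero, mul_one, one_mul]
      refine Real.exp_le_exp.2 ?_
      have : s * (1 - Real.cos θ) ≤ s * (r ^ 2 / 2) :=
        mul_le_mul_of_nonneg_left (by linarith) hs
      nlinarith [sq_nonneg r]
    · simp only [Int.cast_zero, zero_mul, Real.cos_zero, mul_one, one_mul]
      exact (Real.exp_pos _).le
  rw [intervalIntegral.integral_const] at h1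
  unfold kern
  calc Real.exp (-2) / Real.pi / √(1 + s) = (2 * Real.pi)⁻¹ * ((r - -r) • Real.exp (-2)) := by
        rw [hr, smul_eq_mul]; field_simp; ring
    _ ≤ _ := mul_le_mul_of_nonneg_left h1 (by positivity)

theorem kern_one_zero (m : ℤ) : kern (fun _ => 1) 0 m = if m = 0 then 1 else 0 := by
  have hπ := Real.pi_pos
  unfold kern
  split_ifs with h
  · subst h
    simp
    field_simp
    ring
  · have hm : (m : ℝ) ≠ 0 := by exact_mod_cast h
    have : ∫ θ in (-Real.pi)..Real.pi, Real.cos (m * θ) = 0 := by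
      rw [intervalIntegral.integral_comp_mul_left (fun θ => Real.cos θ) hm, integral_cos]
      simp [Real.sin_int_mul_pi]
    simp [this]

theorem kern_one_add_cos (s : ℝ) (m : ℤ) : kern (fun θ => 1 + Real.cos θ) s m =
    kern (fun _ => 1) s m + (kern (fun _ => 1) s (m + 1) + kern (fun _ => 1) s (m - 1)) / 2 := by
  have i1 := intervalIntegrable_kern (g := fun _ => 1) continuous_const s (m + 1)
  have i2 := intervalIntegrable_kern (g := fun _ => 1) continuous_const s (m - 1)
  have i3 := intervalIntegrable_kern (g := fun _ => 1) continuous_const s m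
  unfold kern
  rw [← mul_add, mul_div_assoc, ← mul_add, ← intervalIntegral.integral_add i1 i2,
    ← intervalIntegral.integral_div, ← intervalIntegral.integral_add i3 ((i1.add i2).div_const 2)]
  congr 2
  funext θ
  push_cast
  rw [add_mul (m : ℝ), sub_mul, one_mul, Real.cos_add, Real.cos_sub]
  ring_nf

/-- The Fourier integral does not show positivity; the comparison principle for `2Δ` carries it over
from time 0. -/
theorem kern_nonneg (hg : Continuous g) (hg0 : ∀ θ, 0 ≤ g θ) (h0 : ∀ m, 0 ≤ kern g 0 m) {s : ℝ}
    (hs : 0 ≤ s) (m : ℤ) : 0 ≤ kern g s m := by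
  let A : (ℤ → ℝ) →ₗ[ℝ] (ℤ → ℝ) :=
    { toFun := fun f m => 2 * (f (m + 1) + f (m - 1) - 2 * f m)
      map_add' := fun f h => by funext m; simp; ring
      map_smul' := fun c f => by funext m; simp; ring }
  have hA : IsSubMarkov 4 A := ⟨by norm_num, fun f M _ hf x => by
    change 2 * (f (x + 1) + f (x - 1) - 2 * f x) + 4 * f x ≤ 4 * M
    linarith [hf (x + 1), hf (x - 1)]⟩
  have hc : Continuous fun s => kern g s 0 :=
    continuous_iff_continuousAt.2 fun s => (kern_hasDerivAt hg s 0).continuousAt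
  obtain ⟨B, hB⟩ := (isCompact_Icc (a := 0) (b := s)).exists_bound_of_continuousOn hc.continuousOn
  have := comparison hA (T := s) (u := fun s m => -kern g s m)
    (u' := fun s m => -(2 * (kern g s (m + 1) + kern g s (m - 1) - 2 * kern g s m)))
    (fun x r _ => (kern_hasDerivAt hg r x).neg.hasDerivWithinAt)
    ⟨B, fun r hr x => (neg_le_abs _).trans ((abs_kern_le hg hg0 r x).trans
      ((le_abs_self _).trans (hB r hr)))⟩ (fun x => by simpa using h0 x)
    (fun r _ x => by
      change _ ≤ 2 * (-kern g r (x + 1) + -kern g r (x - 1) - 2 * -kern g r x)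
      linarith) s ⟨hs, le_rfl⟩ m
  linarith

/-! ### Product kernels on `ℤ^d` and the lattice Laplacian. -/

variable {d : ℕ}

/-- The lattice Laplacian. -/
def lap (f : Site d → ℝ) (z : Site d) : ℝ :=
  ∑ l : Fin d, (f (z + Pi.single l 1) + f (z - Pi.single l 1) - 2 * f z)

/-- The `d`-fold product of `kern g s`. -/
noncomputable def heat (g : ℝ → ℝ) (s : ℝ) (z : Site d) : ℝ := ∏ l, kern g s (z l)

theorem heat_shift (g : ℝ → ℝ) (s : ℝ) (z : Site d) (l : Fin d) (c : ℤ) :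
    heat g s (z + Pi.single l c) =
      (∏ j ∈ Finset.univ.erase l, kern g s (z j)) * kern g s (z l + c) := by
  unfold heat
  rw [← Finset.prod_erase_mul _ _ (Finset.mem_univ l)]
  congr 1
  · refine Finset.prod_congr rfl fun j hj => ?_
    simp [Finset.ne_of_mem_erase hj]
  · simp

theorem heat_hasDerivAt (hg : Continuous g) (s : ℝ) (z : Site d) :
    HasDerivAt (fun s => heat g s z) (2 * lap (heat g s) z) s := by
  have h := HasDerivAt.fun_finsetProd (u := Finset.univ) (f := fun l s => kern g s (z l))
    (x := s) fun l _ => kern_hasDerivAt hg s (z l)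
  refine h.congr_deriv ?_
  rw [lap, Finset.mul_sum]
  refine Finset.sum_congr rfl fun l _ => ?_
  have h0 := heat_shift g s z l 0
  rw [Pi.single_zero, add_zero, add_zero] at h0
  rw [sub_eq_add_neg z, ← Pi.single_neg, heat_shift, heat_shift, h0, smul_eq_mul,
    ← sub_eq_add_neg]
  ring

theorem heat_neg (g : ℝ → ℝ) (s : ℝ) (z : Site d) : heat g s (-z) = heat g s z := by
  simp [heat, kern_neg]

theorem abs_heat_le (hg : Continuous g) (hg0 : ∀ θ, 0 ≤ g θ) (s : ℝ) (z : Site d) :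
    |heat g s z| ≤ heat g s (0 : Site d) := by
  unfold heat
  rw [Finset.abs_prod]
  exact Finset.prod_le_prod (fun _ _ => abs_nonneg _) fun l _ => abs_kern_le hg hg0 s (z l)

theorem heat_continuous (hg : Continuous g) (z : Site d) : Continuous fun s => heat g s z :=
  continuous_iff_continuousAt.2 fun s => (heat_hasDerivAt hg s z).continuousAt

theorem heat_zero_le (hg : Continuous g) (hg0 : ∀ θ, 0 ≤ g θ) (hg2 : ∀ θ, g θ ≤ 2) {s : ℝ}
    (hs : 0 ≤ s) : heat g s (0 : Site d) ≤ (Real.exp 8 / √(1 + s)) ^ d := by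
  unfold heat
  simp only [Pi.zero_apply, Finset.prod_const, Finset.card_univ, Fintype.card_fin]
  exact pow_le_pow_left₀ ((abs_nonneg _).trans (abs_kern_le hg hg0 s 0)) (kern_zero_le hg hg2 hs) d

theorem heat_one_zero (z : Site d) : heat (fun _ => 1) 0 z = if z = 0 then 1 else 0 := by
  unfold heat
  simp only [kern_one_zero]
  split_ifs with h
  · simp [h]
  · obtain ⟨l, hl⟩ := Function.ne_iff.1 h
    exact Finset.prod_eq_zero (Finset.mem_univ l) (by simpa using hl)

theorem kern_one_add_cos_initial_nonneg (m : ℤ) : 0 ≤ kern (fun θ => 1 + Real.cos θ) 0 m := by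
  rw [kern_one_add_cos, kern_one_zero, kern_one_zero, kern_one_zero]
  split_ifs <;> norm_num

theorem heat_one_add_cos_nonneg {s : ℝ} (hs : 0 ≤ s) (z : Site d) :
    0 ≤ heat (fun θ => 1 + Real.cos θ) s z :=
  Finset.prod_nonneg fun _ _ => kern_nonneg (by fun_prop)
    (fun θ => by linarith [Real.neg_one_le_cos θ]) kern_one_add_cos_initial_nonneg hs _

/-- `1 + cos θ` is the transform of `δ₀ + (δ₁ + δ₋₁)/2`, so twice the product kernel dominates the
adjacency indicator at time 0. -/
theorem heat_one_add_cos_initial (l : Fin d) :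
    heat (fun θ => 1 + Real.cos θ) 0 (Pi.single l 1 : Site d) = 1 / 2 := by
  have := heat_shift (fun θ => 1 + Real.cos θ) 0 (0 : Site d) l 1
  rw [zero_add] at this
  rw [this]
  simp [kern_one_add_cos, kern_one_zero]

end Kernel

/-! ### Stirring of labelled tuples, its killed version, and the motion of a difference of two
labels. -/

section Tuples

variable {ι : Type*} [Fintype ι] [DecidableEq ι] {d : ℕ}

/-- Injective labelled tuples of sites. -/
abbrev Tuple (ι : Type*) (d : ℕ) : Type _ := {x : ι → Site d // Function.Injective x}

/-- Exchange the contents of `y` and `y + e_l`. -/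
def move (y : Site d) (l : Fin d) (x : Tuple ι d) : Tuple ι d :=
  ⟨fun i => Equiv.swap y (y + Pi.single l 1) (x.1 i),
    (Equiv.swap y (y + Pi.single l 1)).injective.comp x.2⟩

/-- Exchange two labels. -/
def relabel (a b : ι) (x : Tuple ι d) : Tuple ι d :=
  ⟨fun i => x.1 (Equiv.swap a b i), x.2.comp (Equiv.swap a b).injective⟩

/-- The edges `(y, l) = {y, y + e_l}` that touch a tuple. -/
def edges (x : ι → Site d) : Finset (Site d × Fin d) :=
  Finset.univ.biUnion fun i => Finset.univ.biUnion fun l =>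
    {(x i, l), (x i - Pi.single l 1, l)}

theorem mem_edges {x : ι → Site d} {e : Site d × Fin d} :
    e ∈ edges x ↔ ∃ i, e.1 = x i ∨ e.1 = x i - Pi.single e.2 1 := by
  obtain ⟨y, l⟩ := e
  simp only [edges, Finset.mem_biUnion, Finset.mem_univ, true_and, Finset.mem_insert,
    Finset.mem_singleton, Prod.mk.injEq]
  constructor
  · rintro ⟨i, l', ⟨h, rfl⟩ | ⟨h, rfl⟩⟩
    exacts [⟨i, Or.inl h⟩, ⟨i, Or.inr h⟩]
  · rintro ⟨i, h | h⟩
    exacts [⟨i, l, Or.inl ⟨h, rfl⟩⟩, ⟨i, l, Or.inr ⟨h, rfl⟩⟩]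

theorem card_edges_le (x : ι → Site d) : (edges x).card ≤ Fintype.card ι * (d * 2) := by
  refine (Finset.card_biUnion_le_card_mul _ _ (d * 2) fun i _ => ?_).trans (by simp)
  refine (Finset.card_biUnion_le_card_mul _ _ 2 fun l _ => Finset.card_le_two).trans (by simp)

theorem swap_apply_of_notMem_edges {x : ι → Site d} {e : Site d × Fin d} (he : e ∉ edges x)
    (i : ι) : Equiv.swap e.1 (e.1 + Pi.single e.2 1) (x i) = x i := by
  rw [mem_edges] at he
  push Not at he
  refine Equiv.swap_apply_of_ne_of_ne (fun h => (he i).1 h.symm) fun h => (he i).2 ?_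
  rw [h, add_sub_cancel_right]

/-- The sites of the labels `a` and `b` are nearest neighbours. -/
def Adj (a b : ι) (x : Tuple ι d) : Prop :=
  ∃ l : Fin d, x.1 b = x.1 a + Pi.single l 1 ∨ x.1 a = x.1 b + Pi.single l 1

open Classical in
/-- Indicator of `Adj`. -/
noncomputable def adjInd (a b : ι) (x : Tuple ι d) : ℝ := if Adj a b x then 1 else 0

theorem adjInd_nonneg (a b : ι) (x : Tuple ι d) : 0 ≤ adjInd a b x := by
  unfold adjInd; split_ifs <;> norm_num

theorem abs_adjInd_le (a b : ι) (x : Tuple ι d) : |adjInd a b x| ≤ 1 := by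
  unfold adjInd; split_ifs <;> norm_num

/-- The generator of the labelled stirring (interchange) process. -/
def stir : (Tuple ι d → ℝ) →ₗ[ℝ] (Tuple ι d → ℝ) where
  toFun G x := ∑ e ∈ edges x.1, (G (move e.1 e.2 x) - G x)
  map_add' G H := by
    funext x
    simp only [Pi.add_apply, ← Finset.sum_add_distrib]
    exact Finset.sum_congr rfl fun e _ => by ring
  map_smul' c G := by
    funext x
    simp only [Pi.smul_apply, smul_eq_mul, Finset.mul_sum, RingHom.id_apply]
    exact Finset.sum_congr rfl fun e _ => by ring

theorem stir_apply (G : Tuple ι d → ℝ) (x : Tuple ι d) :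
    stir G x = ∑ e ∈ edges x.1, (G (move e.1 e.2 x) - G x) := rfl

/-- The stirring generator on functions antisymmetric in `a, b`: the exchange of `a` and `b` is
replaced by killing. -/
noncomputable def killed (a b : ι) : (Tuple ι d → ℝ) →ₗ[ℝ] (Tuple ι d → ℝ) where
  toFun G x := stir G x - adjInd a b x * (G (relabel a b x) + G x)
  map_add' G H := by
    funext x
    simp only [map_add, Pi.add_apply]
    ring
  map_smul' c G := by
    funext x
    simp only [map_smul, Pi.smul_apply, smul_eq_mul, RingHom.id_apply]
    ring

theorem killed_apply (a b : ι) (G : Tuple ι d → ℝ) (x : Tuple ι d) :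
    killed a b G x = stir G x - adjInd a b x * (G (relabel a b x) + G x) := rfl

theorem single_ne_zero (l : Fin d) : (Pi.single l 1 : Site d) ≠ 0 := by
  intro h; simpa using congrFun h l

theorem single_add_single_ne_zero (l : Fin d) :
    (Pi.single l 1 + Pi.single l 1 : Site d) ≠ 0 := by
  intro h; simpa using congrFun h l

/-- If `a` and `b` are adjacent, their exchange is one of the moves. -/
theorem exists_move_eq_relabel {a b : ι} {x : Tuple ι d} (h : Adj a b x) :
    ∃ e ∈ edges x.1, move e.1 e.2 x = relabel a b x := by
  have hgen : ∀ a b : ι, ∀ l, x.1 b = x.1 a + Pi.single l 1 → move (x.1 a) l x = relabel a b x := by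
    intro a b l hl
    ext i : 2
    change Equiv.swap (x.1 a) (x.1 a + Pi.single l 1) (x.1 i) = x.1 (Equiv.swap a b i)
    rw [← hl]
    exact (x.2.map_swap a b i).symm
  obtain ⟨l, hl | hl⟩ := h
  · exact ⟨(x.1 a, l), mem_edges.2 ⟨a, Or.inl rfl⟩, hgen a b l hl⟩
  · refine ⟨(x.1 b, l), mem_edges.2 ⟨b, Or.inl rfl⟩, ?_⟩
    rw [hgen b a l hl, relabel, relabel]
    simp only [Equiv.swap_comm]

/-- A bound on the total rate of the stirring process. -/
def rate (ι : Type*) [Fintype ι] (d : ℕ) : ℝ := (Fintype.card ι * (d * 2) : ℕ) + 2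

theorem rate_nonneg : 0 ≤ rate ι d := by unfold rate; positivity

theorem stir_le {f : Tuple ι d → ℝ} {M : ℝ} (hf : ∀ y, f y ≤ M) (S : Finset (Site d × Fin d))
    (x : Tuple ι d) (hS : S ⊆ edges x.1) :
    ∑ e ∈ S, (f (move e.1 e.2 x) - f x) ≤ (rate ι d - 2) * (M - f x) := by
  calc ∑ e ∈ S, (f (move e.1 e.2 x) - f x) ≤ ∑ _e ∈ S, (M - f x) :=
        Finset.sum_le_sum fun e _ => by linarith [hf (move e.1 e.2 x)]
    _ = S.card * (M - f x) := by rw [Finset.sum_const, nsmul_eq_mul]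
    _ ≤ _ := by
      refine mul_le_mul_of_nonneg_right ?_ (by linarith [hf x])
      have := (Finset.card_le_card hS).trans (card_edges_le x.1)
      unfold rate
      rw [add_sub_cancel_right]
      exact_mod_cast this

theorem isSubMarkov_stir : IsSubMarkov (rate ι d) (stir (ι := ι) (d := d)) := by
  refine ⟨rate_nonneg, fun f M _ hf x => ?_⟩
  have := stir_le hf (edges x.1) x subset_rfl
  rw [stir_apply]
  linarith [hf x]

/-- At an adjacent pair the exchange term `G ∘ relabel - G` and the correction `-(G ∘ relabel + G)`
add up to `-2G`: killing at rate 2, which the extra `2` in `rate` absorbs. -/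
theorem isSubMarkov_killed (a b : ι) : IsSubMarkov (rate ι d) (killed (d := d) a b) := by
  refine ⟨rate_nonneg, fun f M hM hf x => ?_⟩
  rw [killed_apply]
  by_cases h : Adj a b x
  · obtain ⟨e, he, hmove⟩ := exists_move_eq_relabel h
    have := stir_le hf ((edges x.1).erase e) x (Finset.erase_subset _ _)
    rw [stir_apply, ← Finset.add_sum_erase _ _ he, hmove, adjInd, if_pos h]
    linarith [hf x]
  · have := isSubMarkov_stir.2 f M hM hf x
    rw [adjInd, if_neg h]
    linarith

theorem killed_le_stir (a b : ι) {G : Tuple ι d → ℝ} (hG : ∀ x, 0 ≤ G x) (x : Tuple ι d) :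
    killed a b G x ≤ stir G x := by
  rw [killed_apply]
  have := mul_nonneg (adjInd_nonneg a b x) (add_nonneg (hG (relabel a b x)) (hG x))
  linarith

/-- This is the part of the generator in one direction `e`. For `u, v` not neighbours along `e`,
each moves independently, whence the doubled second difference. If they are neighbours, the common
edge only flips the sign of the difference, which an even `g` ignores; the subtracted term removes
the two moves to 0 that free walkers would make. -/
theorem sum_exchange {V : Type*} [AddCommGroup V] [DecidableEq V] {u v e : V} (huv : u ≠ v)
    (he : e ≠ 0) (he2 : e + e ≠ 0) (g : V → ℝ) (hg : ∀ z, g (-z) = g z) :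
    ∑ y ∈ ({u, u - e, v, v - e} : Finset V),
      (g (Equiv.swap y (y + e) u - Equiv.swap y (y + e) v) - g (u - v)) =
    2 * (g (u - v + e) + g (u - v - e) - 2 * g (u - v)) -
      if v = u + e ∨ u = v + e then 2 * (g 0 - g (u - v)) else 0 := by
  have e1 : ∀ w : V, w ≠ w - e := fun w h => he (by simpa using h.symm)
  have e2 : ∀ w : V, w ≠ w + e := fun w h => he (by simpa using h)
  have e3 : ∀ w : V, w + e ≠ w - e := fun w h => he2 (by
    have : (w + e) - (w - e) = 0 := sub_eq_zero.2 h
    rw [← this]; abel)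
  by_cases h1 : v = u + e
  · subst h1
    have hs : ({u, u - e, u + e, u + e - e} : Finset V) = {u, u - e, u + e} := by
      ext y; simp only [Finset.mem_insert, Finset.mem_singleton, add_sub_cancel_right]; tauto
    rw [hs, Finset.sum_insert (by simp [e1, e2]), Finset.sum_insert (by simp [(e3 u).symm]),
      Finset.sum_singleton, if_pos (Or.inl rfl), Equiv.swap_apply_left, Equiv.swap_apply_right,
      sub_add_cancel, Equiv.swap_apply_right, Equiv.swap_apply_of_ne_of_ne (e3 u) (e2 u).symm,
      Equiv.swap_apply_left,
      Equiv.swap_apply_of_ne_of_ne (e2 u) (by rw [add_assoc]; simpa using he2)]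
    have a1 : u - (u + e) = -e := by abel
    have a2 : u + e - u = e := by abel
    have a3 : u - e - (u + e) = -(e + e) := by abel
    have a4 : u - (u + e + e) = -(e + e) := by abel
    have a5 : -e + e = 0 := by abel
    have a6 : -e - e = -(e + e) := by abel
    rw [a2, a1, a3, a4, a5, a6, hg, hg]
    ring
  by_cases h2 : u = v + e
  · subst h2
    have hs : ({v + e, v + e - e, v, v - e} : Finset V) = {v + e, v, v - e} := by
      ext y; simp only [Finset.mem_insert, Finset.mem_singleton, add_sub_cancel_right]; tauto
    rw [hs, Finset.sum_insert (by simp [e3, (e2 v).symm]), Finset.sum_insert (by simp [e1]),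
      Finset.sum_singleton, if_pos (Or.inr rfl), Equiv.swap_apply_left, Equiv.swap_apply_left,
      sub_add_cancel, Equiv.swap_apply_right, Equiv.swap_apply_of_ne_of_ne (e3 v) (e2 v).symm,
      Equiv.swap_apply_right,
      Equiv.swap_apply_of_ne_of_ne (e2 v) (by rw [add_assoc]; simpa using he2)]
    have a1 : v - (v + e) = -e := by abel
    have a2 : v + e - v = e := by abel
    have a3 : v + e + e - v = e + e := by abel
    have a4 : v + e - (v - e) = e + e := by abel
    rw [a2, a1, a3, a4, sub_self, hg]
    ring
  have h3 : u ≠ v - e := fun h => h1 (by rw [h]; abel)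
  have h4 : v ≠ u - e := fun h => h2 (by rw [h]; abel)
  rw [Finset.sum_insert (by simp [e1, huv, h3]),
    Finset.sum_insert (by simp [h4.symm, huv]), Finset.sum_insert (by simp [e1]),
    Finset.sum_singleton, if_neg (by tauto), Equiv.swap_apply_left,
    Equiv.swap_apply_of_ne_of_ne huv.symm h1, sub_add_cancel, Equiv.swap_apply_right,
    Equiv.swap_apply_of_ne_of_ne h4 huv.symm, Equiv.swap_apply_left,
    Equiv.swap_apply_of_ne_of_ne huv h2, sub_add_cancel, Equiv.swap_apply_right,
    Equiv.swap_apply_of_ne_of_ne h3 huv]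
  have a1 : u + e - v = u - v + e := by abel
  have a2 : u - e - v = u - v - e := by abel
  have a3 : u - (v + e) = u - v - e := by abel
  have a4 : u - (v - e) = u - v + e := by abel
  rw [a1, a2, a3, a4]
  ring

/-- The stirring generator on even functions of the difference of two labels. -/
theorem stir_diff {i j : ι} (hij : i ≠ j) {g : Site d → ℝ} (hg : ∀ z, g (-z) = g z)
    (x : Tuple ι d) :
    stir (fun x => g (x.1 i - x.1 j)) x = 2 * lap g (x.1 i - x.1 j) -
      adjInd i j x * (2 * (g 0 - g (x.1 i - x.1 j))) := by
  have huv : x.1 i ≠ x.1 j := fun h => hij (x.2 h)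
  rw [stir_apply, ← Finset.sum_fiberwise _ (fun e => e.2)]
  have h1 : ∀ l : Fin d, ∑ e ∈ edges x.1 with e.2 = l,
      (g ((move e.1 e.2 x).1 i - (move e.1 e.2 x).1 j) - g (x.1 i - x.1 j)) =
      2 * (g (x.1 i - x.1 j + Pi.single l 1) + g (x.1 i - x.1 j - Pi.single l 1) -
        2 * g (x.1 i - x.1 j)) -
      if x.1 j = x.1 i + Pi.single l 1 ∨ x.1 i = x.1 j + Pi.single l 1 then
        2 * (g 0 - g (x.1 i - x.1 j)) else 0 := by
    intro l
    -- Edges in direction `l` touching only other labels leave the difference unchanged, so the sum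
    -- reduces to the edges at `x i` and `x j`.
    rw [← sum_exchange huv (single_ne_zero l) (single_add_single_ne_zero l) g hg]
    refine Eq.trans ?_ (Finset.sum_image (f := fun e : Site d × Fin d =>
        g ((move e.1 e.2 x).1 i - (move e.1 e.2 x).1 j) - g (x.1 i - x.1 j))
      (g := fun y : Site d => (y, l)) (fun y _ y' _ h => (Prod.mk.inj h).1))
    symm
    refine Finset.sum_subset (fun e he => ?_) fun e he hne => ?_
    · simp only [Finset.mem_image, Finset.mem_insert, Finset.mem_singleton] at he
      obtain ⟨y, hy, rfl⟩ := he
      rw [Finset.mem_filter, mem_edges]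
      refine ⟨?_, rfl⟩
      rcases hy with h | h | h | h
      exacts [⟨i, Or.inl h⟩, ⟨i, Or.inr h⟩, ⟨j, Or.inl h⟩, ⟨j, Or.inr h⟩]
    · obtain ⟨y, l'⟩ := e
      obtain rfl : l' = l := (Finset.mem_filter.1 he).2
      have hy : y ∉ ({x.1 i, x.1 i - Pi.single l' 1, x.1 j, x.1 j - Pi.single l' 1} :
          Finset (Site d)) := fun h => hne (Finset.mem_image_of_mem _ h)
      simp only [Finset.mem_insert, Finset.mem_singleton, not_or] at hy
      have hfix : ∀ k, y ≠ x.1 k → y ≠ x.1 k - Pi.single l' 1 → (move y l' x).1 k = x.1 k :=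
        fun k hk hk' => Equiv.swap_apply_of_ne_of_ne hk.symm fun h => hk' (by rw [h]; abel)
      change g ((move y l' x).1 i - (move y l' x).1 j) - _ = 0
      rw [hfix i hy.1 hy.2.1, hfix j hy.2.2.1 hy.2.2.2, sub_self]
  rw [Finset.sum_congr rfl fun l _ => h1 l, Finset.sum_sub_distrib, lap, Finset.mul_sum]
  congr 1
  unfold adjInd
  split_ifs with h
  · obtain ⟨l, hl⟩ := h
    rw [Finset.sum_eq_single l, if_pos hl, one_mul]
    -- Two sites are neighbours along at most one direction, so exactly one correction term
    -- survives.
    · intro l' _ hne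
      rw [if_neg]
      intro hl'
      have h2 : ∀ c c' : ℤ, c ≠ 0 → (Pi.single l c : Site d) = Pi.single l' c' → False := by
        intro c c' hc h
        have := congrFun h l
        simp [hne.symm] at this
        exact hc this
      have key : ∀ l, (x.1 j = x.1 i + Pi.single l 1 ∨ x.1 i = x.1 j + Pi.single l 1) →
          ∃ c : ℤ, c ≠ 0 ∧ x.1 j - x.1 i = Pi.single l c := by
        rintro l (h | h)
        · exact ⟨1, one_ne_zero, by rw [h]; abel⟩
        · exact ⟨-1, by norm_num, by rw [h, Pi.single_neg]; abel⟩
      obtain ⟨c, hc, h3⟩ := key l hl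
      obtain ⟨c', _, h4⟩ := key l' hl'
      exact h2 c c' hc (h3.symm.trans h4)
    · simp
  · rw [zero_mul]
    exact Finset.sum_eq_zero fun l _ => if_neg fun hl => h ⟨l, hl⟩

theorem Adj.exists_diff {a b : ι} {x : Tuple ι d} (h : Adj a b x) :
    ∃ l : Fin d, x.1 a - x.1 b = Pi.single l 1 ∨ x.1 a - x.1 b = -Pi.single l 1 := by
  obtain ⟨l, h | h⟩ := h
  · exact ⟨l, Or.inr (by rw [h]; abel)⟩
  · exact ⟨l, Or.inl (by rw [h]; abel)⟩

/-- Heat kernel bound for the probability that two labels are adjacent. -/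
theorem le_heat_of_flow {i j : ι} (hij : i ≠ j) {A : (Tuple ι d → ℝ) →ₗ[ℝ] (Tuple ι d → ℝ)} {Λ : ℝ}
    (hA : IsSubMarkov Λ A) (hAs : ∀ G : Tuple ι d → ℝ, (∀ x, 0 ≤ G x) → ∀ x, A G x ≤ stir G x)
    {w : ℝ → Tuple ι d → ℝ} (hw0 : w 0 = adjInd i j)
    (hw : ∀ s x, HasDerivAt (fun s => w s x) (A (w s) x) s)
    (hwb : ∀ T, ∃ B, ∀ s ∈ Icc 0 T, ∀ x, |w s x| ≤ B) {s : ℝ} (hs : 0 ≤ s) (x : Tuple ι d) :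
    w s x ≤ 2 * (Real.exp 8 / √(1 + s)) ^ d := by
  -- A nonnegative transform puts the maximum of the kernel at 0. The exclusion correction in
  -- `stir_diff` then has a favourable sign, and the free kernel is a supersolution.
  set g : ℝ → ℝ := fun θ => 1 + Real.cos θ with hgdef
  have hg : Continuous g := by fun_prop
  have hg0 : ∀ θ, 0 ≤ g θ := fun θ => by
    have := Real.neg_one_le_cos θ
    simp only [hgdef]; linarith
  have hg2 : ∀ θ, g θ ≤ 2 := fun θ => by
    have := Real.cos_le_one θ
    simp only [hgdef]; linarith
  obtain ⟨B, hB⟩ := hwb s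
  have hheat0 : ∀ r ∈ Icc 0 s, ∀ z : Site d, 0 ≤ heat g r z := fun r hr z =>
    heat_one_add_cos_nonneg hr.1 z
  have h := comparison hA (T := s) (u := fun r x => w r x - 2 * heat g r (x.1 i - x.1 j))
    (u' := fun r x => A (w r) x - 2 * (2 * lap (heat g r) (x.1 i - x.1 j)))
    (fun x r _ => ((hw r x).sub ((heat_hasDerivAt hg r _).const_mul 2)).hasDerivWithinAt)
    ⟨B, fun r hr x => by
      have := (abs_le.1 (hB r hr x)).2
      have := hheat0 r hr (x.1 i - x.1 j)
      linarith⟩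
    (fun x => by
      rw [hw0]
      by_cases hadj : Adj i j x
      · rw [adjInd, if_pos hadj]
        obtain ⟨l, hl | hl⟩ := hadj.exists_diff
        · rw [hl, heat_one_add_cos_initial]; norm_num
        · rw [hl, heat_neg, heat_one_add_cos_initial]; norm_num
      · rw [adjInd, if_neg hadj]
        have := heat_one_add_cos_nonneg le_rfl (x.1 i - x.1 j)
        linarith)
    (fun r hr x => by
      have e : (fun x : Tuple ι d => w r x - 2 * heat g r (x.1 i - x.1 j)) =
          w r - (2 : ℝ) • fun x : Tuple ι d => heat g r (x.1 i - x.1 j) := rfl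
      rw [e, map_sub, map_smul]
      simp only [Pi.sub_apply, Pi.smul_apply, smul_eq_mul]
      have h1 := hAs (fun x : Tuple ι d => heat g r (x.1 i - x.1 j))
        (fun x => hheat0 r hr _) x
      rw [stir_diff hij (heat_neg g r) x] at h1
      have h2 := (le_abs_self _).trans (abs_heat_le hg hg0 r (x.1 i - x.1 j))
      have h3 : 0 ≤ adjInd i j x * (2 * (heat g r 0 - heat g r (x.1 i - x.1 j))) :=
        mul_nonneg (adjInd_nonneg _ _ _) (by linarith)
      linarith)
    s ⟨hs, le_rfl⟩ x
  have h1 := (le_abs_self _).trans (abs_heat_le hg hg0 s (x.1 i - x.1 j))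
  have h2 := heat_zero_le (d := d) hg hg0 hg2 hs
  linarith

theorem heat_one_single (s : ℝ) (l : Fin d) :
    lap (heat (fun _ => 1) s) (0 : Site d) =
      2 * d * (heat (fun _ => 1) s (Pi.single l 1) - heat (fun _ => 1) s (0 : Site d)) := by
  have h : ∀ (l' : Fin d), heat (fun _ => 1) s (Pi.single l' 1 : Site d) =
      kern (fun _ => 1) s 0 ^ (d - 1) * kern (fun _ => 1) s 1 := by
    intro l'
    have := heat_shift (fun _ => 1) s (0 : Site d) l' 1
    simpa using this
  unfold lap
  simp only [zero_add, zero_sub, heat_neg, h]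
  simp
  ring

/-- Two walkers that are killed when they meet: a flow bounded by `c` at time `r` is at most
`c / (4 ∫₀ᴺ p)` at time `r + N` if the killed pair is adjacent. -/
theorem killed_flow_le {a b : ι} (hab : a ≠ b) {w : ℝ → Tuple ι d → ℝ}
    (hw : ∀ s x, HasDerivAt (fun s => w s x) (killed a b (w s) x) s)
    (hwb : ∀ T, ∃ B, ∀ s ∈ Icc 0 T, ∀ x, |w s x| ≤ B) {r c N : ℝ} (hr : 0 ≤ r) (hN : 0 ≤ N)
    (hc : 0 ≤ c) (hwr : ∀ x, w r x ≤ c) (x : Tuple ι d) (hx : Adj a b x) :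
    w (r + N) x * (4 * ∫ u in (0 : ℝ)..N, heat (fun _ => 1) u (0 : Site d)) ≤ c := by
  set p : ℝ → Site d → ℝ := fun u z => heat (fun _ => 1) u z with hp
  have hg : Continuous fun _ : ℝ => (1 : ℝ) := continuous_const
  have hg0 : ∀ θ : ℝ, (0 : ℝ) ≤ (fun _ => 1) θ := fun _ => zero_le_one
  have hpc : ∀ z, Continuous fun u => p u z := fun z => heat_continuous hg z
  have hpi : ∀ z t t', IntervalIntegrable (fun u => p u z) volume t t' := fun z t t' =>
    (hpc z).intervalIntegrable _ _
  have hple : ∀ u z, p u z ≤ p u 0 := fun u z =>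
    (le_abs_self _).trans (abs_heat_le hg hg0 u z)
  have hp0 : ∀ u, 0 ≤ p u 0 := fun u => (abs_nonneg _).trans (abs_heat_le hg hg0 u 0)
  set I : ℝ → Site d → ℝ := fun s z => ∫ u in (0 : ℝ)..s, p u z with hI
  have hI' : ∀ s z, HasDerivAt (fun s => I s z) (p s z) s := fun s z =>
    intervalIntegral.integral_hasDerivAt_right (hpi z _ _)
      ((hpc z).stronglyMeasurableAtFilter _ _) (hpc z).continuousAt
  have hIlap : ∀ s z, 2 * lap (I s) z = p s z - p 0 z := by
    intro s z
    have h1 : ∫ u in (0 : ℝ)..s, 2 * lap (p u) z = p s z - p 0 z :=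
      intervalIntegral.integral_eq_sub_of_hasDerivAt (fun u _ => heat_hasDerivAt hg u z)
        (Continuous.intervalIntegrable (continuous_const.mul (continuous_finsetSum _ fun l _ =>
          ((hpc _).add (hpc _)).sub (continuous_const.mul (hpc _)))) _ _)
    rw [← h1, intervalIntegral.integral_const_mul]
    congr 1
    unfold lap
    rw [intervalIntegral.integral_finsetSum fun l _ => (((hpi _ _ _).add (hpi _ _ _)).sub
      ((hpi _ _ _).const_mul 2))]
    refine Finset.sum_congr rfl fun l _ => ?_
    rw [intervalIntegral.integral_sub ((hpi _ _ _).add (hpi _ _ _)) ((hpi _ _ _).const_mul 2),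
      intervalIntegral.integral_add (hpi _ _ _) (hpi _ _ _), intervalIntegral.integral_const_mul]
  have hIneg : ∀ s z, I s (-z) = I s z := fun s z => by simp only [hI, hp, heat_neg]
  have hImono : ∀ s ∈ Icc 0 N, ∀ z, I s z ≤ I N 0 := by
    intro s hs z
    calc I s z ≤ I s 0 := intervalIntegral.integral_mono_on hs.1 (hpi _ _ _) (hpi _ _ _)
          fun u _ => hple u z
      _ ≤ I N 0 := intervalIntegral.integral_mono_interval le_rfl hs.1 hs.2
          (Eventually.of_forall fun u => hp0 u) (hpi _ _ _)
  have hK : 0 ≤ I N 0 := intervalIntegral.integral_nonneg hN fun u _ => hp0 u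
  obtain ⟨B, hB⟩ := hwb (r + N)
  -- The barrier is `R = I_N(0) - I_s(z)` with `I_s = ∫₀ˢ p`. Off the origin `2ΔI_s = p_s`, so `R`
  -- solves the free equation; on adjacent pairs, the exclusion and killing corrections together
  -- equal `-2R(0) ≤ 0`. Hence `R` is a supersolution.
  have h := comparison (isSubMarkov_killed (d := d) a b) (T := N)
    (u := fun s x => w (r + s) x * I N 0 - c * (I N 0 - I s (x.1 a - x.1 b)))
    (u' := fun s x => killed a b (w (r + s)) x * I N 0 - c * (0 - p s (x.1 a - x.1 b)))
    (fun x s _ => by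
      have h1 : HasDerivAt (fun s => w (r + s) x) (killed a b (w (r + s)) x) s := by
        simpa using (hw (r + s) x).comp_const_add r s
      exact ((h1.mul_const _).sub
        (((hasDerivAt_const s _).sub (hI' s _)).const_mul c)).hasDerivWithinAt)
    ⟨B * I N 0, fun s hs x => by
      have h1 := (abs_le.1 (hB (r + s) ⟨by linarith [hs.1], by linarith [hs.2]⟩ x)).2
      have h2 := mul_nonneg hc (sub_nonneg.2 (hImono s hs (x.1 a - x.1 b)))
      have h3 := mul_le_mul_of_nonneg_right h1 hK
      linarith⟩
    (fun x => by
      have h1 : I 0 (x.1 a - x.1 b) = 0 := by simp [hI]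
      rw [add_zero, h1, sub_zero, ← sub_mul]
      exact mul_nonpos_of_nonpos_of_nonneg (by linarith [hwr x]) hK)
    (fun s hs x => by
      set R : Site d → ℝ := fun z => I N 0 - I s z with hR
      have e : (fun x : Tuple ι d => w (r + s) x * I N 0 - c * (I N 0 - I s (x.1 a - x.1 b))) =
          I N 0 • w (r + s) - c • fun x : Tuple ι d => R (x.1 a - x.1 b) := by
        funext y; simp [hR, mul_comm]
      rw [e, map_sub, map_smul, map_smul]
      simp only [Pi.sub_apply, Pi.smul_apply, smul_eq_mul]
      have hz : x.1 a - x.1 b ≠ 0 := fun h => hab (x.2 (sub_eq_zero.1 h))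
      have hRneg : ∀ z, R (-z) = R z := fun z => by simp only [hR, hIneg]
      have hRlap : 2 * lap R (x.1 a - x.1 b) = - p s (x.1 a - x.1 b) := by
        have h1 := hIlap s (x.1 a - x.1 b)
        have h2 : p 0 (x.1 a - x.1 b) = 0 := by
          simp only [hp]; rw [heat_one_zero, if_neg hz]
        have h3 : lap R (x.1 a - x.1 b) = - lap (I s) (x.1 a - x.1 b) := by
          unfold lap
          rw [← Finset.sum_neg_distrib]
          exact Finset.sum_congr rfl fun l _ => by simp only [hR]; ring
        rw [h3]; linarith
      have h1 : killed a b (fun x : Tuple ι d => R (x.1 a - x.1 b)) x =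
          - p s (x.1 a - x.1 b) - adjInd a b x * (2 * R 0) := by
        rw [killed_apply, stir_diff hab hRneg, hRlap]
        have h4 : R ((relabel a b x).1 a - (relabel a b x).1 b) = R (x.1 a - x.1 b) := by
          change R (x.1 (Equiv.swap a b a) - x.1 (Equiv.swap a b b)) = _
          rw [Equiv.swap_apply_left, Equiv.swap_apply_right, ← hRneg, neg_sub]
        rw [h4]; ring
      have h2 : 0 ≤ adjInd a b x * (2 * R 0) :=
        mul_nonneg (adjInd_nonneg _ _ _) (by have := hImono s hs 0; simp only [hR]; linarith)
      have h3 : c * killed a b (fun x : Tuple ι d => R (x.1 a - x.1 b)) x ≤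
          c * (0 - p s (x.1 a - x.1 b)) := mul_le_mul_of_nonneg_left (by linarith) hc
      linarith)
    N ⟨hN, le_rfl⟩ x
  obtain ⟨l, hl⟩ := hx.exists_diff
  have hIe : I N (x.1 a - x.1 b) = I N (Pi.single l 1) := by
    rcases hl with hl | hl
    · rw [hl]
    · rw [hl, hIneg]
  have hd : (1 : ℝ) ≤ d := by
    have : 0 < d := l.pos
    exact_mod_cast this
  have hlap0 : 2 * (2 * d * (I N (Pi.single l 1) - I N 0)) = p N 0 - p 0 0 := by
    rw [← hIlap N 0]
    congr 1
    have h1 : lap (I N) 0 = ∫ u in (0 : ℝ)..N, lap (p u) 0 := by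
      unfold lap
      rw [intervalIntegral.integral_finsetSum fun l _ => (((hpi _ _ _).add (hpi _ _ _)).sub
        ((hpi _ _ _).const_mul 2))]
      refine Finset.sum_congr rfl fun l _ => ?_
      rw [intervalIntegral.integral_sub ((hpi _ _ _).add (hpi _ _ _)) ((hpi _ _ _).const_mul 2),
        intervalIntegral.integral_add (hpi _ _ _) (hpi _ _ _),
        intervalIntegral.integral_const_mul]
    rw [h1]
    simp only [hp, heat_one_single _ l]
    rw [intervalIntegral.integral_const_mul,
      intervalIntegral.integral_sub (hpi _ _ _) (hpi _ _ _)]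
  have hp00 : p 0 0 = 1 := by simp only [hp]; rw [heat_one_zero, if_pos rfl]
  -- At the origin `2ΔI_N = p_N(0) - 1`, that is `4d (I_N(0) - I_N(e)) = 1 - p_N(0) ≤ 1`: from an
  -- adjacent start the barrier at time `N` is at most `c/4`, however large `I_N(0)` is.
  have hfin : 4 * (I N 0 - I N (Pi.single l 1)) ≤ 1 := by
    have h1 := hp0 N
    have h2 : 0 ≤ I N 0 - I N (Pi.single l 1) := sub_nonneg.2 (hImono N ⟨hN, le_rfl⟩ _)
    nlinarith
  change w (r + N) x * I N 0 - c * (I N 0 - I N (x.1 a - x.1 b)) ≤ 0 at h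
  rw [hIe] at h
  have := mul_le_mul_of_nonneg_left hfin hc
  change w (r + N) x * (4 * I N 0) ≤ c
  linarith

end Tuples

/-! ### Expected adjacency times in dimension two and in dimension at least three. -/

section Potentials

variable {ι : Type*} [Fintype ι] [DecidableEq ι] {d : ℕ}

/-- `H` is the time-integrated potential of `f` for the generator `A`: `H' = A H + f`, `H 0 = 0`. -/
structure IsPotential {X : Type*} (A : (X → ℝ) →ₗ[ℝ] (X → ℝ)) (f : X → ℝ) (H : ℝ → X → ℝ) :
    Prop where
  zero : H 0 = 0
  deriv : ∀ s x, HasDerivAt (fun s => H s x) (A (H s) x + f x) s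
  bdd : ∀ T, ∃ B, ∀ s ∈ Icc 0 T, ∀ x, |H s x| ≤ B

/-- Up to time `N`, the expected time that a given pair is adjacent is at most `C α`; if moreover
the labels `a`, `b` start adjacent and are killed when they meet, it is at most `C β`. -/
structure PotentialBound (ι : Type*) [Fintype ι] [DecidableEq ι] (d : ℕ) (C α β N : ℝ) :
    Prop where
  stir_le : ∀ i j : ι, i ≠ j → ∃ H : ℝ → Tuple ι d → ℝ, IsPotential stir (adjInd i j) H ∧
    ∀ s ∈ Icc 0 N, ∀ x, H s x ≤ C * α
  killed_le : ∀ a b i j : ι, a ≠ b → i ≠ j → ∃ H : ℝ → Tuple ι d → ℝ,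
    IsPotential (killed a b) (adjInd i j) H ∧
    ∀ s ∈ Icc 0 N, ∀ x, Adj a b x → H s x ≤ C * β

theorem hasDerivAt_log_one_add {s : ℝ} (hs : 0 ≤ s) :
    HasDerivAt (fun s => Real.log (1 + s)) (1 / (1 + s)) s := by
  have h1 : HasDerivAt (fun s : ℝ => 1 + s) 1 s := by
    simpa using (hasDerivAt_id s).const_add 1
  exact h1.log (by positivity)

theorem log_le_integral_heat {r : ℝ} (hr : 0 ≤ r) :
    (Real.exp (-2) / Real.pi) ^ 2 * Real.log (1 + r) ≤
      ∫ u in (0 : ℝ)..r, heat (fun _ => 1) u (0 : Site 2) := by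
  have hc : Continuous fun u => heat (fun _ => 1) u (0 : Site 2) :=
    heat_continuous continuous_const _
  refine le_of_deriv_le (T := r)
    (f := fun r => (Real.exp (-2) / Real.pi) ^ 2 * Real.log (1 + r))
    (g := fun r => ∫ u in (0 : ℝ)..r, heat (fun _ => 1) u (0 : Site 2))
    (fun s hs => (hasDerivAt_log_one_add hs.1).const_mul _)
    (fun s _ => intervalIntegral.integral_hasDerivAt_right (hc.intervalIntegrable _ _)
      (hc.stronglyMeasurableAtFilter _ _) hc.continuousAt) (by simp) (fun s hs => ?_) r
    ⟨hr, le_rfl⟩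
  have h1 := le_kern_one_zero hs.1
  have h2 : heat (fun _ => 1) s (0 : Site 2) = kern (fun _ => 1) s 0 ^ 2 := by
    simp [heat]
  rw [h2]
  refine le_trans (le_of_eq ?_) (pow_le_pow_left₀ (by positivity) h1 2)
  rw [div_pow _ (√(1 + s)), Real.sq_sqrt (by linarith [hs.1])]
  ring

/-- The domination `A ≤ stir` on nonnegative functions lets one statement serve both the stirring
and the killed process. -/
theorem exists_flow_bound {i j : ι} (hij : i ≠ j) {A : (Tuple ι d → ℝ) →ₗ[ℝ] (Tuple ι d → ℝ)}
    {Λ : ℝ} (hA : IsSubMarkov Λ A)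
    (hAs : ∀ G : Tuple ι d → ℝ, (∀ x, 0 ≤ G x) → ∀ x, A G x ≤ stir G x) :
    ∃ w H : ℝ → Tuple ι d → ℝ, IsPotential A (adjInd i j) H ∧
      (∀ s x, HasDerivAt (fun s => H s x) (w s x) s) ∧
      (∀ s x, HasDerivAt (fun s => w s x) (A (w s) x) s) ∧
      (∀ T, ∃ B, ∀ s ∈ Icc 0 T, ∀ x, |w s x| ≤ B) ∧
      ∀ s, 0 ≤ s → ∀ x, w s x ≤ 2 * (Real.exp 8 / √(1 + s)) ^ d := by
  obtain ⟨w, H, hw0, hH0, hw, hH, hHw, hb⟩ := exists_potential hA (abs_adjInd_le (d := d) i j)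
  have hwb : ∀ T, ∃ B, ∀ s ∈ Icc 0 T, ∀ x, |w s x| ≤ B := fun T => by
    obtain ⟨B, hB⟩ := hb T
    exact ⟨B, fun s hs x => (hB s hs x).1⟩
  refine ⟨w, H, ⟨hH0, hH, fun T => ?_⟩, hHw, hw, hwb, fun s hs x =>
    le_heat_of_flow hij hA hAs hw0 hw hwb hs x⟩
  obtain ⟨B, hB⟩ := hb T
  exact ⟨B, fun s hs x => (hB s hs x).2⟩

theorem potentialBound_two (ι : Type*) [Fintype ι] [DecidableEq ι] : ∃ C, 0 ≤ C ∧ ∀ N, 0 ≤ N →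
    PotentialBound ι 2 C (Real.log (1 + N)) (Real.log (1 + Real.log (1 + N))) N := by
  set c₀ : ℝ := (Real.exp (-2) / Real.pi) ^ 2 with hc₀
  have hc₀pos : 0 < c₀ := by positivity
  -- This allows adding the plain heat bound to the killed one, replacing `log(1+s/2)` by `1 +
  -- log(1+s/2)` in the denominator and so avoiding the singularity at `s = 0`.
  have hc₀le : 4 * c₀ ≤ 1 := by
    have h1 : Real.exp (-2) / Real.pi ≤ 1 / 3 :=
      div_le_div₀ zero_le_one (Real.exp_le_one_iff.2 (by norm_num)) (by norm_num)
        Real.pi_gt_three.le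
    have h2 : c₀ ≤ (1 / 3) ^ 2 := pow_le_pow_left₀ (by positivity) h1 2
    linarith
  have hsq : ∀ s : ℝ, 0 ≤ s → 2 * (Real.exp 8 / √(1 + s)) ^ 2 =
      2 * Real.exp 8 ^ 2 * (1 / (1 + s)) := by
    intro s hs
    rw [div_pow, Real.sq_sqrt (by linarith)]; ring
  set D : ℝ := 2 / (4 * c₀) * (2 * Real.exp 8 ^ 2) with hD
  have hD0 : 0 ≤ D := by positivity
  have hE0 : (0 : ℝ) ≤ 2 * Real.exp 8 ^ 2 := by positivity
  refine ⟨2 * Real.exp 8 ^ 2 + 2 * D, by positivity, fun N hN => ⟨?_, ?_⟩⟩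
  · intro i j hij
    obtain ⟨w, H, hH, hHw, -, -, hw⟩ := exists_flow_bound (d := 2) hij isSubMarkov_stir
      fun G _ x => le_rfl
    refine ⟨H, hH, fun s hs x => ?_⟩
    have h1 := le_of_deriv_le (T := N) (f := fun s => H s x)
      (g := fun s => 2 * Real.exp 8 ^ 2 * Real.log (1 + s)) (fun s _ => hHw s x)
      (fun s hs => (hasDerivAt_log_one_add hs.1).const_mul _) (by simp [hH.zero])
      (fun s hs => (hw s hs.1 x).trans (hsq s hs.1).le) s hs
    have h2 : Real.log (1 + s) ≤ Real.log (1 + N) :=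
      Real.log_le_log (by linarith [hs.1]) (by linarith [hs.2])
    have h3 : 0 ≤ Real.log (1 + N) := Real.log_nonneg (by linarith)
    have h4 := mul_le_mul_of_nonneg_left h2 hE0
    have h5 := mul_nonneg hD0 h3
    linarith
  · intro a b i j hab hij
    obtain ⟨w, H, hH, hHw, hwd, hwb, hw⟩ := exists_flow_bound (d := 2) hij
      (isSubMarkov_killed a b) fun G hG x => killed_le_stir a b hG x
    refine ⟨H, hH, fun s hs x hx => ?_⟩
    have hlog : ∀ s : ℝ, 0 ≤ s → 0 ≤ Real.log (1 + s) := fun s hs =>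
      Real.log_nonneg (by linarith)
    have hwle : ∀ s ∈ Icc 0 N, w s x ≤
        D * (1 / (1 + s / 2) / (1 + Real.log (1 + s / 2))) := by
      intro s hs
      have hr : 0 ≤ s / 2 := by linarith [hs.1]
      have hl := hlog _ hr
      rcases le_or_gt (w s x) 0 with hneg | hpos
      · exact hneg.trans (by positivity)
      -- The time is split in halves: one half gives the heat kernel decay `1/(1+s/2)`, the other
      -- the survival factor `1/log`.
      have h1 := killed_flow_le hab hwd hwb hr hr (by positivity) (hw (s / 2) hr) x hx
      rw [add_halves, hsq _ hr] at h1
      have h2 := hw s hs.1 x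
      rw [hsq _ hs.1] at h2
      have h3 : 2 * Real.exp 8 ^ 2 * (1 / (1 + s)) ≤ 2 * Real.exp 8 ^ 2 * (1 / (1 + s / 2)) := by
        gcongr; linarith
      have h4 := mul_le_mul_of_nonneg_left (log_le_integral_heat hr) hpos.le
      have h5 : w s x * (4 * c₀ * (1 + Real.log (1 + s / 2))) ≤
          2 * (2 * Real.exp 8 ^ 2 * (1 / (1 + s / 2))) := by
        have := mul_le_mul_of_nonneg_left hc₀le hpos.le
        linarith
      rw [← le_div_iff₀ (by positivity)] at h5
      refine h5.trans (le_of_eq ?_)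
      rw [hD]
      field_simp
    -- The primitive of `1/((1+s/2)(1+log(1+s/2)))` is `2 log(1+log(1+s/2))`.
    have h1 := le_of_deriv_le (T := N) (f := fun s => H s x)
      (g := fun s => 2 * D * Real.log (1 + Real.log (1 + s / 2))) (fun s _ => hHw s x)
      (g' := fun s => 2 * D * (1 / (1 + s / 2) * (1 / 2) / (1 + Real.log (1 + s / 2))))
      (fun s hs => by
        have hr : 0 ≤ s / 2 := by linarith [hs.1]
        have hl := hlog _ hr
        have h2 : HasDerivAt (fun s : ℝ => s / 2) (1 / 2) s := (hasDerivAt_id s).div_const 2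
        have h3 : HasDerivAt (fun s : ℝ => Real.log (1 + s / 2)) (1 / (1 + s / 2) * (1 / 2)) s :=
          ((h2.const_add 1).log (by positivity)).congr_deriv (by ring)
        exact ((h3.const_add 1).log (by positivity)).const_mul _) (by simp [hH.zero])
      (fun s hs => (hwle s hs).trans (le_of_eq (by ring))) s hs
    have hl := hlog (s / 2) (by linarith [hs.1])
    have h2 : Real.log (1 + s / 2) ≤ Real.log (1 + N) :=
      Real.log_le_log (by linarith [hs.1]) (by linarith [hs.1, hs.2])
    have h3 : Real.log (1 + Real.log (1 + s / 2)) ≤ Real.log (1 + Real.log (1 + N)) :=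
      Real.log_le_log (by linarith) (by linarith)
    have h4 : 0 ≤ Real.log (1 + Real.log (1 + N)) := hlog _ (hlog _ hN)
    have h5 := mul_le_mul_of_nonneg_left h3 hD0
    have h6 := mul_nonneg hE0 h4
    linarith

theorem potentialBound_three (ι : Type*) [Fintype ι] [DecidableEq ι] (hd : 3 ≤ d) :
    ∃ C, 0 ≤ C ∧ ∀ N, 0 ≤ N → PotentialBound ι d C 1 1 N := by
  set C : ℝ := 2 * Real.exp 8 ^ d * 2 with hC
  have hC0 : 0 ≤ C := by positivity
  have main : ∀ (f f' : ℝ → ℝ) (N : ℝ), f 0 = 0 → (∀ s, HasDerivAt f (f' s) s) →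
      (∀ s, 0 ≤ s → f' s ≤ 2 * (Real.exp 8 / √(1 + s)) ^ d) → ∀ s ∈ Icc 0 N, f s ≤ C * 1 := by
    intro f f' N h0 hf hle s hs
    -- As `1/√(1+s) ≤ 1`, the power `d ≥ 3` may be lowered to 3, and `(1+s)^{-3/2}` has the bounded
    -- primitive `2(1 - (1+s)^{-1/2})`.
    have h1 := le_of_deriv_le (T := N) (f := f) (g := fun s => C * (1 - (√(1 + s))⁻¹))
      (g' := fun s => 2 * Real.exp 8 ^ d * (1 / √(1 + s)) ^ 3)
      (fun s _ => hf s) (fun s hs => by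
        have hpos : 0 < 1 + s := by linarith [hs.1]
        have h2 : HasDerivAt (fun s : ℝ => 1 + s) 1 s := by
          simpa using (hasDerivAt_id s).const_add 1
        have h3 := (((h2.sqrt hpos.ne').fun_inv (by positivity)).const_sub 1).const_mul C
        refine h3.congr_deriv ?_
        have : 0 < √(1 + s) := Real.sqrt_pos.2 hpos
        rw [hC]
        field_simp) (by simp [h0])
      (fun s hs => by
        refine (hle s hs.1).trans ?_
        rw [div_eq_mul_one_div, mul_pow, ← mul_assoc]
        refine mul_le_mul_of_nonneg_left ?_ (by positivity)
        have h2 : 1 ≤ √(1 + s) := by rw [Real.one_le_sqrt]; linarith [hs.1]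
        exact pow_le_pow_of_le_one (by positivity) (by rw [div_le_one (by positivity)]; exact h2)
          hd) s hs
    refine h1.trans (mul_le_mul_of_nonneg_left ?_ hC0)
    have : 0 ≤ (√(1 + s))⁻¹ := by positivity
    linarith
  refine ⟨C, hC0, fun N hN => ⟨?_, ?_⟩⟩
  · intro i j hij
    obtain ⟨w, H, hH, hHw, -, -, hw⟩ := exists_flow_bound (d := d) hij isSubMarkov_stir
      fun G _ x => le_rfl
    exact ⟨H, hH, fun s hs x => main _ _ N (by simp [hH.zero]) (fun s => hHw s x)
      (fun s hs => hw s hs x) s hs⟩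
  · intro a b i j _ hij
    obtain ⟨w, H, hH, hHw, -, -, hw⟩ := exists_flow_bound (d := d) hij
      (isSubMarkov_killed a b) fun G hG x => killed_le_stir a b hG x
    exact ⟨H, hH, fun s hs x _ => main _ _ N (by simp [hH.zero]) (fun s => hHw s x)
      (fun s hs => hw s hs x) s hs⟩

end Potentials

/-! ### Local functions and the generator as a finite sum. -/

section LocalFunctions

variable {d : ℕ}

theorem IsLocal.const (c : ℝ) : IsLocal fun _ : Config d => c :=
  ⟨∅, fun _ _ _ => rfl⟩

theorem isLocal_occ (z : Site d) : IsLocal fun η : Config d => occ η z :=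
  ⟨{z}, fun η η' h => by simp only [occ, h z (by simp)]⟩

theorem IsLocal.map₂ {f h : Config d → ℝ} (hf : IsLocal f) (hh : IsLocal h) (Φ : ℝ → ℝ → ℝ) :
    IsLocal fun η => Φ (f η) (h η) := by
  classical
  obtain ⟨S, hS⟩ := hf
  obtain ⟨S', hS'⟩ := hh
  refine ⟨S ∪ S', fun η η' h => ?_⟩
  have h1 := hS (x := η) (y := η') fun i hi => h i (by simp at hi ⊢; exact Or.inl hi)
  have h2 := hS' (x := η) (y := η') fun i hi => h i (by simp at hi ⊢; exact Or.inr hi)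
  simp only [h1, h2]

theorem IsLocal.add {f h : Config d → ℝ} (hf : IsLocal f) (hh : IsLocal h) :
    IsLocal fun η => f η + h η := hf.map₂ hh (· + ·)

theorem IsLocal.sub {f h : Config d → ℝ} (hf : IsLocal f) (hh : IsLocal h) :
    IsLocal fun η => f η - h η := hf.map₂ hh (· - ·)

theorem IsLocal.mul {f h : Config d → ℝ} (hf : IsLocal f) (hh : IsLocal h) :
    IsLocal fun η => f η * h η := hf.map₂ hh (· * ·)

theorem IsLocal.prod {κ : Type*} (A : Finset κ) {f : κ → Config d → ℝ} (hf : ∀ i, IsLocal (f i)) :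
    IsLocal fun η => ∏ i ∈ A, f i η := by
  classical
  induction A using Finset.induction_on with
  | empty => simpa using IsLocal.const 1
  | insert a A ha ih => simpa only [Finset.prod_insert ha] using (hf a).mul ih

theorem IsLocal.sum {κ : Type*} (A : Finset κ) {f : κ → Config d → ℝ} (hf : ∀ i, IsLocal (f i)) :
    IsLocal fun η => ∑ i ∈ A, f i η := by
  classical
  induction A using Finset.induction_on with
  | empty => simpa using IsLocal.const 0
  | insert a A ha ih => simpa only [Finset.sum_insert ha] using (hf a).add ih

theorem IsLocal.comp_swap {f : Config d → ℝ} (hf : IsLocal f) (y y' : Site d) :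
    IsLocal fun η => f (swap η y y') := by
  classical
  obtain ⟨S, hS⟩ := hf
  refine ⟨S.image (Equiv.swap y y'), fun η η' h => hS fun i hi => ?_⟩
  exact h _ (Finset.mem_coe.2 (Finset.mem_image_of_mem _ hi))

theorem IsLocal.exists_eq {f : Config d → ℝ} (hf : IsLocal f) :
    ∃ (S : Finset (Site d)) (F : (S → Bool) → ℝ), ∀ η, f η = F (S.restrict η) := by
  obtain ⟨S, hS⟩ := hf
  obtain ⟨F, hF⟩ := dependsOn_iff_exists_comp.1 hS
  exact ⟨S, F, fun η => congrFun hF η⟩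

theorem IsLocal.continuous {f : Config d → ℝ} (hf : IsLocal f) : Continuous f := by
  obtain ⟨S, F, hF⟩ := hf.exists_eq
  obtain rfl : f = fun η => F (S.restrict η) := funext hF
  exact (continuous_of_discreteTopology (f := F)).comp (Finset.continuous_restrict S)

theorem IsLocal.measurable {f : Config d → ℝ} (hf : IsLocal f) : Measurable f := by
  obtain ⟨S, F, hF⟩ := hf.exists_eq
  obtain rfl : f = fun η => F (S.restrict η) := funext hF
  exact (Measurable.of_discrete (f := F)).comp (Finset.measurable_restrict S)

theorem IsLocal.exists_bound {f : Config d → ℝ} (hf : IsLocal f) : ∃ B, ∀ η, |f η| ≤ B := by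
  obtain ⟨S, F, hF⟩ := hf.exists_eq
  obtain ⟨B, hB⟩ := (Set.finite_range fun v => |F v|).bddAbove
  exact ⟨B, fun η => by rw [hF]; exact hB ⟨_, rfl⟩⟩

theorem IsLocal.integrable {f : Config d → ℝ} (hf : IsLocal f) (μ : Measure (Config d))
    [IsFiniteMeasure μ] : Integrable f μ := by
  obtain ⟨B, hB⟩ := hf.exists_bound
  exact Integrable.of_bound hf.measurable.aestronglyMeasurable B (Eventually.of_forall hB)

/-- An exchange away from the sites `x i` does not change `f`. The finite index set `edges x` is the
one used by `stir`, so the two generators can be compared edge by edge. -/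
theorem gen_eq_sum {ι : Type*} [Fintype ι] {f : Config d → ℝ} {x : ι → Site d}
    (hf : DependsOn f (range x)) (η : Config d) :
    gen f η = ∑ e ∈ edges x, (f (swap η e.1 (e.1 + Pi.single e.2 1)) - f η) := by
  classical
  have hzero : ∀ e ∉ edges x, f (swap η e.1 (e.1 + Pi.single e.2 1)) - f η = 0 := by
    intro e he
    rw [sub_eq_zero]
    refine hf fun z hz => ?_
    obtain ⟨i, rfl⟩ := hz
    simp only [swap, swap_apply_of_notMem_edges he i]
  have hsub : edges x ⊆ (edges x).image Prod.fst ×ˢ Finset.univ := fun e he =>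
    Finset.mem_product.2 ⟨Finset.mem_image_of_mem _ he, Finset.mem_univ _⟩
  unfold gen
  rw [tsum_eq_sum (s := (edges x).image Prod.fst) fun y hy => Finset.sum_eq_zero fun l _ =>
    hzero (y, l) fun h => hy (Finset.mem_image_of_mem Prod.fst h)]
  refine (Finset.sum_product' _ _
    (fun y l => f (swap η y (y + Pi.single l 1)) - f η)).symm.trans ?_
  exact (Finset.sum_subset hsub fun e _ he => hzero e he).symm

theorem IsLocal.exists_gen_eq {f : Config d → ℝ} (hf : IsLocal f) :
    ∃ S : Finset (Site d), DependsOn f (range (Subtype.val : S → Site d)) := by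
  obtain ⟨S, hS⟩ := hf
  exact ⟨S, by simpa using hS⟩

theorem IsLocal.gen {f : Config d → ℝ} (hf : IsLocal f) : IsLocal (gen f) := by
  obtain ⟨S, hS⟩ := hf.exists_gen_eq
  rw [show SSEP.gen f = fun η => _ from funext fun η => gen_eq_sum hS η]
  exact IsLocal.sum _ fun e => (hf.comp_swap _ _).sub hf

theorem gen_sub_mul {f h : Config d → ℝ} (hf : IsLocal f) (hh : IsLocal h) (c : ℝ)
    (η : Config d) : gen (fun η => f η - c * h η) η = gen f η - c * gen h η := by
  classical
  obtain ⟨S, hS⟩ := hf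
  obtain ⟨S', hS'⟩ := hh
  have hr : range (Subtype.val : ↥(S ∪ S') → Site d) = ↑(S ∪ S') := by ext; simp
  have h1 : DependsOn f (range (Subtype.val : ↥(S ∪ S') → Site d)) := by
    rw [hr]; intro η η' h; exact hS fun i hi => h i (by simp at hi ⊢; exact Or.inl hi)
  have h2 : DependsOn h (range (Subtype.val : ↥(S ∪ S') → Site d)) := by
    rw [hr]; intro η η' h; exact hS' fun i hi => h i (by simp at hi ⊢; exact Or.inr hi)
  have h3 : DependsOn (fun η => f η - c * h η) (range (Subtype.val : ↥(S ∪ S') → Site d)) := by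
    intro η η' h; simp only [h1 h, h2 h]
  rw [gen_eq_sum h1, gen_eq_sum h2, gen_eq_sum h3, Finset.mul_sum, ← Finset.sum_sub_distrib]
  exact Finset.sum_congr rfl fun e _ => by ring

end LocalFunctions

/-! ### Evolution of densities and centred correlations. -/

section Flow

variable {ι : Type*} [Fintype ι] [DecidableEq ι] {d : ℕ}

/-- A family of laws solving the forward equation of the generator `L` on local functions. -/
structure IsFlow (μ : ℝ → Measure (Config d)) : Prop where
  prob : ∀ s, IsProbabilityMeasure (μ s)
  deriv : ∀ f, IsLocal f → ∀ s, 0 ≤ s →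
    HasDerivWithinAt (fun s => ∫ η, f η ∂μ s) (∫ η, gen f η ∂μ s) (Ici 0) s

/-- Mean occupation number. -/
noncomputable def dens (μ : ℝ → Measure (Config d)) (s : ℝ) (z : Site d) : ℝ :=
  ∫ η, occ η z ∂μ s

/-- Centred correlation of the occupation numbers at the sites `x i`, `i ∈ A`. -/
noncomputable def corr (μ : ℝ → Measure (Config d)) (A : Finset ι) (s : ℝ) (x : ι → Site d) : ℝ :=
  ∫ η, ∏ i ∈ A, (occ η (x i) - dens μ s (x i)) ∂μ s

variable {μ : ℝ → Measure (Config d)}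

/-- The forward equation only covers fixed local functions, while the centring depends on time.
Factors are peeled off one at a time; the arbitrary prefactor `g` absorbs `occ η (x a)` in the
induction. -/
theorem IsFlow.hasDerivWithinAt_prod (hμ : IsFlow μ) (x : ι → Site d) (r r' : ι → ℝ → ℝ) {s : ℝ}
    (hs : 0 ≤ s) (hr : ∀ i, HasDerivWithinAt (r i) (r' i s) (Ici 0) s) (A : Finset ι) :
    ∀ g : Config d → ℝ, IsLocal g →
    HasDerivWithinAt (fun s => ∫ η, g η * ∏ i ∈ A, (occ η (x i) - r i s) ∂μ s)
      ((∫ η, gen (fun η => g η * ∏ i ∈ A, (occ η (x i) - r i s)) η ∂μ s) -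
        ∑ i ∈ A, r' i s * ∫ η, g η * ∏ l ∈ A.erase i, (occ η (x l) - r l s) ∂μ s) (Ici 0) s := by
  have hprob := hμ.prob
  have hloc : ∀ (A : Finset ι) (s : ℝ), IsLocal fun η : Config d => ∏ i ∈ A, (occ η (x i) - r i s) :=
    fun A s => IsLocal.prod A fun i => (isLocal_occ (x i)).sub (IsLocal.const _)
  induction A using Finset.induction_on with
  | empty =>
    intro g hg
    simpa using hμ.deriv g hg s hs
  | insert a A ha ih =>
    intro g hg
    have hga : IsLocal fun η : Config d => g η * occ η (x a) := hg.mul (isLocal_occ _)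
    have hsplit : ∀ (B : Finset ι) s (c : ℝ), ∫ η, g η * ((occ η (x a) - c) *
        ∏ i ∈ B, (occ η (x i) - r i s)) ∂μ s =
        (∫ η, (g η * occ η (x a)) * ∏ i ∈ B, (occ η (x i) - r i s) ∂μ s) -
          c * ∫ η, g η * ∏ i ∈ B, (occ η (x i) - r i s) ∂μ s := by
      intro B s c
      rw [← integral_const_mul, ← integral_sub ((hga.mul (hloc B s)).integrable _)
        (((hg.mul (hloc B s)).integrable _).const_mul c)]
      exact integral_congr_ae (Eventually.of_forall fun η => by ring)
    have h1 := (ih _ hga).sub ((hr a).mul (ih _ hg))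
    have hfun : (fun s => ∫ η, g η * ∏ i ∈ insert a A, (occ η (x i) - r i s) ∂μ s) =
        fun s => (∫ η, (g η * occ η (x a)) * ∏ i ∈ A, (occ η (x i) - r i s) ∂μ s) -
          r a s * ∫ η, g η * ∏ i ∈ A, (occ η (x i) - r i s) ∂μ s := by
      funext s
      simp only [Finset.prod_insert ha]
      exact hsplit A s (r a s)
    rw [hfun]
    refine h1.congr_deriv ?_
    have hgen : ∫ η, gen (fun η => g η * ∏ i ∈ insert a A, (occ η (x i) - r i s)) η ∂μ s =
        (∫ η, gen (fun η => (g η * occ η (x a)) * ∏ i ∈ A, (occ η (x i) - r i s)) η ∂μ s) -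
        r a s * ∫ η, gen (fun η => g η * ∏ i ∈ A, (occ η (x i) - r i s)) η ∂μ s := by
      rw [← integral_const_mul, ← integral_sub ((hga.mul (hloc A s)).gen.integrable _)
        (((hg.mul (hloc A s)).gen.integrable _).const_mul _)]
      refine integral_congr_ae (Eventually.of_forall fun η => ?_)
      simp only
      rw [← gen_sub_mul (hga.mul (hloc A s)) (hg.mul (hloc A s))]
      congr 1
      funext η
      rw [Finset.prod_insert ha]
      ring
    have hsum : ∑ i ∈ A, r' i s * ∫ η, g η *
          ∏ l ∈ (insert a A).erase i, (occ η (x l) - r l s) ∂μ s =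
        (∑ i ∈ A, r' i s * ∫ η, (g η * occ η (x a)) *
          ∏ l ∈ A.erase i, (occ η (x l) - r l s) ∂μ s) -
        r a s * ∑ i ∈ A, r' i s * ∫ η, g η * ∏ l ∈ A.erase i, (occ η (x l) - r l s) ∂μ s := by
      rw [Finset.mul_sum, ← Finset.sum_sub_distrib]
      refine Finset.sum_congr rfl fun i hi => ?_
      have hia : i ≠ a := fun h => ha (h ▸ hi)
      have : (insert a A).erase i = insert a (A.erase i) := Finset.erase_insert_of_ne hia.symm
      rw [this]
      simp only [Finset.prod_insert fun h => ha (Finset.mem_of_mem_erase h)]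
      rw [hsplit (A.erase i) s (r a s)]
      ring
    rw [hgen, Finset.sum_insert ha, Finset.erase_insert ha, hsum]
    ring

theorem IsFlow.dens_deriv_edges (hμ : IsFlow μ) (x : ι → Site d) (i : ι) {s : ℝ} (hs : 0 ≤ s) :
    HasDerivWithinAt (fun s => dens μ s (x i)) (∑ e ∈ edges x,
      (dens μ s (Equiv.swap e.1 (e.1 + Pi.single e.2 1) (x i)) - dens μ s (x i))) (Ici 0) s := by
  have hprob := hμ.prob
  refine (hμ.deriv _ (isLocal_occ (x i)) s hs).congr_deriv ?_
  have hdep : DependsOn (fun η : Config d => occ η (x i)) (range x) := fun η η' h => by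
    simp only [occ, h (x i) ⟨i, rfl⟩]
  rw [integral_congr_ae (Eventually.of_forall fun η => gen_eq_sum hdep η), integral_finsetSum]
  · refine Finset.sum_congr rfl fun e _ => ?_
    rw [integral_sub]
    · rfl
    · exact ((isLocal_occ (x i)).comp_swap _ _).integrable _
    · exact (isLocal_occ (x i)).integrable _
  · exact fun e _ => (((isLocal_occ (x i)).comp_swap _ _).sub (isLocal_occ (x i))).integrable _

theorem IsFlow.dens_deriv (hμ : IsFlow μ) (z : Site d) {s : ℝ} (hs : 0 ≤ s) :
    HasDerivWithinAt (fun s => dens μ s z) (lap (dens μ s) z) (Ici 0) s := by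
  refine (hμ.dens_deriv_edges (fun _ : Unit => z) () hs).congr_deriv ?_
  have he : edges (fun _ : Unit => z) = Finset.univ.biUnion fun l : Fin d =>
      {(z, l), (z - Pi.single l 1, l)} := by
    unfold edges; simp
  rw [he, Finset.sum_biUnion, lap]
  · refine Finset.sum_congr rfl fun l _ => ?_
    rw [Finset.sum_pair]
    · simp only [Equiv.swap_apply_left, sub_add_cancel, Equiv.swap_apply_right]
      ring
    · intro h
      exact single_ne_zero l (sub_eq_self.1 (Prod.mk.inj h).1.symm)
  · intro l _ l' _ hne
    rw [Function.onFun, Finset.disjoint_left]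
    intro e h h'
    simp only [Finset.mem_insert, Finset.mem_singleton] at h h'
    apply hne
    rcases h with h | h <;> rcases h' with h' | h' <;>
      exact (congrArg Prod.snd h).symm.trans (congrArg Prod.snd h')

theorem dens_mem (hμ : IsFlow μ) (s : ℝ) (z : Site d) : dens μ s z ∈ Icc (0 : ℝ) 1 := by
  have hprob := hμ.prob
  have h : ∀ η : Config d, 0 ≤ occ η z ∧ occ η z ≤ 1 := fun η => by
    unfold occ; split_ifs <;> norm_num
  constructor
  · exact integral_nonneg fun η => (h η).1
  · calc dens μ s z ≤ ∫ _η : Config d, (1 : ℝ) ∂μ s :=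
        integral_mono ((isLocal_occ z).integrable _) (integrable_const _) fun η => (h η).2
      _ = 1 := by simp

theorem isSubMarkov_lap : ∃ A : (Site d → ℝ) →ₗ[ℝ] (Site d → ℝ), (∀ f z, A f z = lap f z) ∧
    IsSubMarkov (2 * d) A := by
  refine ⟨{ toFun := lap, map_add' := fun f h => ?_, map_smul' := fun c f => ?_ },
    fun f z => rfl, by positivity, fun f M _ hf z => ?_⟩
  · funext z
    simp only [lap, Pi.add_apply, ← Finset.sum_add_distrib]
    exact Finset.sum_congr rfl fun l _ => by ring
  · funext z
    simp only [lap, Pi.smul_apply, smul_eq_mul, Finset.mul_sum, RingHom.id_apply]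
    exact Finset.sum_congr rfl fun l _ => by ring
  · change lap f z + _ ≤ _
    have : lap f z ≤ ∑ _l : Fin d, (2 * M - 2 * f z) :=
      Finset.sum_le_sum fun l _ => by
        linarith [hf (z + Pi.single l 1), hf (z - Pi.single l 1)]
    rw [Finset.sum_const, Finset.card_univ, Fintype.card_fin, nsmul_eq_mul] at this
    linarith

/-- The discrete gradient of the density stays below its initial bound. -/
theorem IsFlow.gradient_le (hμ : IsFlow μ) {θ : ℝ}
    (h0 : ∀ z (l : Fin d), |dens μ 0 (z + Pi.single l 1) - dens μ 0 z| ≤ θ) {s : ℝ} (hs : 0 ≤ s)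
    (z : Site d) (l : Fin d) : |dens μ s (z + Pi.single l 1) - dens μ s z| ≤ θ := by
  obtain ⟨A, hA, hAM⟩ := isSubMarkov_lap (d := d)
  have hθ : 0 ≤ θ := (abs_nonneg _).trans (h0 z l)
  have main : ∀ ε : ℝ, |ε| = 1 → ε * (dens μ s (z + Pi.single l 1) - dens μ s z) - θ ≤ 0 := by
    intro ε hε
    refine comparison hAM (T := s)
      (u := fun s z => ε * (dens μ s (z + Pi.single l 1) - dens μ s z) - θ)
      (u' := fun s z => ε * (lap (dens μ s) (z + Pi.single l 1) - lap (dens μ s) z))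
      (fun z r hr => (((hμ.dens_deriv _ hr.1).sub (hμ.dens_deriv z hr.1)).const_mul ε).sub_const θ)
      ⟨1, fun r _ z => ?_⟩ (fun z => ?_) (fun r _ z => ?_) s ⟨hs, le_rfl⟩ z
    · have h1 := dens_mem hμ r (z + Pi.single l 1)
      have h2 := dens_mem hμ r z
      have h3 : |dens μ r (z + Pi.single l 1) - dens μ r z| ≤ 1 :=
        abs_le.2 ⟨by linarith [h1.1, h2.2], by linarith [h1.2, h2.1]⟩
      have h4 := le_abs_self (ε * (dens μ r (z + Pi.single l 1) - dens μ r z))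
      rw [abs_mul, hε, one_mul] at h4
      linarith
    · have h4 := le_abs_self (ε * (dens μ 0 (z + Pi.single l 1) - dens μ 0 z))
      rw [abs_mul, hε, one_mul] at h4
      linarith [h0 z l]
    · rw [hA]
      refine le_of_eq ?_
      unfold lap
      -- The Laplacian commutes with shifts and kills constants, so the discrete gradient minus `θ`
      -- solves the same equation.
      rw [← Finset.sum_sub_distrib, Finset.mul_sum]
      refine Finset.sum_congr rfl fun l' _ => ?_
      rw [add_right_comm z, sub_add_eq_add_sub]
      ring_nf
  rw [abs_le]
  have h1 := main 1 (by simp)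
  have h2 := main (-1) (by simp)
  constructor <;> linarith

/-- The contribution of an exchange `σ` to the time derivative of `corr`. -/
noncomputable def edgeTerm (μ : ℝ → Measure (Config d)) (A : Finset ι) (s : ℝ) (x : ι → Site d)
    (σ : Site d → Site d) (η : Config d) : ℝ :=
  ∏ i ∈ A, (occ η (σ (x i)) - dens μ s (x i)) - ∏ i ∈ A, (occ η (x i) - dens μ s (x i)) -
    ∑ i ∈ A, (dens μ s (σ (x i)) - dens μ s (x i)) *
      ∏ l ∈ A.erase i, (occ η (x l) - dens μ s (x l))

theorem isLocal_centred (A : Finset ι) (z : ι → Site d) (r : ι → ℝ) :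
    IsLocal fun η : Config d => ∏ i ∈ A, (occ η (z i) - r i) :=
  IsLocal.prod A fun i => (isLocal_occ (z i)).sub (IsLocal.const _)

theorem IsFlow.corr_deriv (hμ : IsFlow μ) (A : Finset ι) (x : ι → Site d) {s : ℝ} (hs : 0 ≤ s) :
    HasDerivWithinAt (fun s => corr μ A s x) (∑ e ∈ edges x,
      ∫ η, edgeTerm μ A s x (Equiv.swap e.1 (e.1 + Pi.single e.2 1)) η ∂μ s) (Ici 0) s := by
  have hprob := hμ.prob
  let r' : ι → ℝ → ℝ := fun i s => ∑ e ∈ edges x,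
    (dens μ s (Equiv.swap e.1 (e.1 + Pi.single e.2 1) (x i)) - dens μ s (x i))
  have hr : ∀ i, HasDerivWithinAt (fun s => dens μ s (x i)) (r' i s) (Ici 0) s :=
    fun i => hμ.dens_deriv_edges x i hs
  have h := hμ.hasDerivWithinAt_prod x (fun i s => dens μ s (x i)) r' hs hr A (fun _ => 1)
    (IsLocal.const 1)
  simp only [one_mul] at h
  have hdep : DependsOn (fun η : Config d => ∏ i ∈ A, (occ η (x i) - dens μ s (x i))) (range x) :=
    fun η η' h => by simp only [occ, h (x _) ⟨_, rfl⟩]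
  have hl : ∀ (B : Finset ι) (z : ι → Site d),
      Integrable (fun η : Config d => ∏ i ∈ B, (occ η (z i) - dens μ s (x i))) (μ s) :=
    fun B z => (isLocal_centred B z _).integrable _
  have hdiff : ∀ e : Site d × Fin d, Integrable (fun η : Config d =>
      ∏ i ∈ A, (occ η (Equiv.swap e.1 (e.1 + Pi.single e.2 1) (x i)) - dens μ s (x i)) -
        ∏ i ∈ A, (occ η (x i) - dens μ s (x i))) (μ s) := fun e => (hl A _).sub (hl A x)
  have hgen : ∫ η, gen (fun η => ∏ i ∈ A, (occ η (x i) - dens μ s (x i))) η ∂μ s =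
      ∑ e ∈ edges x, ∫ η, (∏ i ∈ A, (occ η (Equiv.swap e.1 (e.1 + Pi.single e.2 1) (x i)) -
        dens μ s (x i)) - ∏ i ∈ A, (occ η (x i) - dens μ s (x i))) ∂μ s := by
    rw [← integral_finsetSum _ fun e _ => hdiff e]
    exact integral_congr_ae (Eventually.of_forall fun η => gen_eq_sum hdep η)
  refine h.congr_deriv ?_
  rw [hgen]
  simp only [r', Finset.sum_mul]
  rw [Finset.sum_comm, ← Finset.sum_sub_distrib]
  refine Finset.sum_congr rfl fun e _ => ?_
  have hi : ∀ i, Integrable (fun η : Config d =>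
      (dens μ s (Equiv.swap e.1 (e.1 + Pi.single e.2 1) (x i)) - dens μ s (x i)) *
        ∏ l ∈ A.erase i, (occ η (x l) - dens μ s (x l))) (μ s) := fun i => (hl _ x).const_mul _
  unfold edgeTerm
  rw [integral_sub (hdiff e) (integrable_finsetSum _ fun i _ => hi i), integral_finsetSum _ fun i _ => hi i]
  simp only [integral_const_mul]

/-- The inhomogeneous term in the evolution equation of `corr`. -/
noncomputable def source (μ : ℝ → Measure (Config d)) (A : Finset ι) (s : ℝ) (x : Tuple ι d) : ℝ :=
  (∑ e ∈ edges x.1, ∫ η, edgeTerm μ A s x.1 (Equiv.swap e.1 (e.1 + Pi.single e.2 1)) η ∂μ s) -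
    stir (fun x : Tuple ι d => corr μ A s x.1) x

theorem IsFlow.corr_ode (hμ : IsFlow μ) (A : Finset ι) (x : Tuple ι d) {s : ℝ} (hs : 0 ≤ s) :
    HasDerivWithinAt (fun s => corr μ A s x.1)
      (stir (fun x : Tuple ι d => corr μ A s x.1) x + source μ A s x) (Ici 0) s :=
  (hμ.corr_deriv A x.1 hs).congr_deriv (by unfold source; ring)

theorem edgeTerm_of_forall_fixed (A : Finset ι) (s : ℝ) (x : ι → Site d) (σ : Site d → Site d)
    (η : Config d) (h : ∀ l ∈ A, σ (x l) = x l) :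
    edgeTerm μ A s x σ η = ∏ l ∈ A, (occ η (σ (x l)) - dens μ s (σ (x l))) -
      ∏ l ∈ A, (occ η (x l) - dens μ s (x l)) := by
  unfold edgeTerm
  have e1 : ∏ l ∈ A, (occ η (σ (x l)) - dens μ s (x l)) =
      ∏ l ∈ A, (occ η (x l) - dens μ s (x l)) :=
    Finset.prod_congr rfl fun l hl => by rw [h l hl]
  have e2 : ∏ l ∈ A, (occ η (σ (x l)) - dens μ s (σ (x l))) =
      ∏ l ∈ A, (occ η (x l) - dens μ s (x l)) :=
    Finset.prod_congr rfl fun l hl => by rw [h l hl]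
  rw [Finset.sum_eq_zero fun l hl => by rw [h l hl, sub_self, zero_mul], e1, e2, sub_zero]

/-- When a single label of `A` moves, the compensating term changes its centring from the old site
to the new one, so the result is a pure increment of the centred product and gives no source. -/
theorem edgeTerm_of_fixed (A : Finset ι) (s : ℝ) (x : ι → Site d) (σ : Site d → Site d)
    (η : Config d) {i : ι} (hi : i ∈ A) (h : ∀ l ∈ A, l ≠ i → σ (x l) = x l) :
    edgeTerm μ A s x σ η = ∏ l ∈ A, (occ η (σ (x l)) - dens μ s (σ (x l))) -
      ∏ l ∈ A, (occ η (x l) - dens μ s (x l)) := by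
  unfold edgeTerm
  have h' : ∀ l ∈ A.erase i, σ (x l) = x l := fun l hl =>
    h l (Finset.mem_of_mem_erase hl) (Finset.ne_of_mem_erase hl)
  have e1 : ∏ l ∈ A.erase i, (occ η (σ (x l)) - dens μ s (x l)) =
      ∏ l ∈ A.erase i, (occ η (x l) - dens μ s (x l)) :=
    Finset.prod_congr rfl fun l hl => by rw [h' l hl]
  have e2 : ∏ l ∈ A.erase i, (occ η (σ (x l)) - dens μ s (σ (x l))) =
      ∏ l ∈ A.erase i, (occ η (x l) - dens μ s (x l)) :=
    Finset.prod_congr rfl fun l hl => by rw [h' l hl]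
  rw [← Finset.mul_prod_erase _ _ hi, ← Finset.mul_prod_erase _ _ hi,
    ← Finset.mul_prod_erase _ _ hi, ← Finset.add_sum_erase _ _ hi, e1, e2,
    Finset.sum_eq_zero fun l hl => by rw [h' l hl, sub_self, zero_mul]]
  ring

/-- With `X, Y` the centred occupations at `x i, x j` and `δ` the density increment, `(Y+δ)(X-δ) -
XY - δY + δX = 2δ(X-Y) - δ²`, times the product over the remaining labels. -/
theorem edgeTerm_of_exchange (A : Finset ι) (s : ℝ) (x : ι → Site d) (σ : Site d → Site d)
    (η : Config d) {i j : ι} (hi : i ∈ A) (hj : j ∈ A) (hij : i ≠ j) (hσi : σ (x i) = x j)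
    (hσj : σ (x j) = x i) (h : ∀ l ∈ A, l ≠ i → l ≠ j → σ (x l) = x l) :
    edgeTerm μ A s x σ η = ∏ l ∈ A, (occ η (σ (x l)) - dens μ s (σ (x l))) -
      ∏ l ∈ A, (occ η (x l) - dens μ s (x l)) +
      (2 * (dens μ s (x j) - dens μ s (x i)) *
        (∏ l ∈ A.erase j, (occ η (x l) - dens μ s (x l)) -
          ∏ l ∈ A.erase i, (occ η (x l) - dens μ s (x l))) -
        (dens μ s (x j) - dens μ s (x i)) ^ 2 *
          ∏ l ∈ (A.erase i).erase j, (occ η (x l) - dens μ s (x l))) := by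
  have hj' : j ∈ A.erase i := Finset.mem_erase.2 ⟨hij.symm, hj⟩
  have hi' : i ∈ A.erase j := Finset.mem_erase.2 ⟨hij, hi⟩
  have h' : ∀ l ∈ (A.erase i).erase j, σ (x l) = x l := fun l hl =>
    h l (Finset.mem_of_mem_erase (Finset.mem_of_mem_erase hl))
      (Finset.ne_of_mem_erase (Finset.mem_of_mem_erase hl)) (Finset.ne_of_mem_erase hl)
  have e1 : ∏ l ∈ (A.erase i).erase j, (occ η (σ (x l)) - dens μ s (x l)) =
      ∏ l ∈ (A.erase i).erase j, (occ η (x l) - dens μ s (x l)) :=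
    Finset.prod_congr rfl fun l hl => by rw [h' l hl]
  have e2 : ∏ l ∈ (A.erase i).erase j, (occ η (σ (x l)) - dens μ s (σ (x l))) =
      ∏ l ∈ (A.erase i).erase j, (occ η (x l) - dens μ s (x l)) :=
    Finset.prod_congr rfl fun l hl => by rw [h' l hl]
  have e3 : ∑ l ∈ (A.erase i).erase j, (dens μ s (σ (x l)) - dens μ s (x l)) *
      ∏ l ∈ A.erase l, (occ η (x l) - dens μ s (x l)) = 0 :=
    Finset.sum_eq_zero fun l hl => by rw [h' l hl, sub_self, zero_mul]
  have e4 : ∏ l ∈ A.erase i, (occ η (x l) - dens μ s (x l)) = (occ η (x j) - dens μ s (x j)) *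
      ∏ l ∈ (A.erase i).erase j, (occ η (x l) - dens μ s (x l)) :=
    (Finset.mul_prod_erase _ _ hj').symm
  have e5 : ∏ l ∈ A.erase j, (occ η (x l) - dens μ s (x l)) = (occ η (x i) - dens μ s (x i)) *
      ∏ l ∈ (A.erase i).erase j, (occ η (x l) - dens μ s (x l)) := by
    rw [Finset.erase_right_comm]; exact (Finset.mul_prod_erase _ _ hi').symm
  have split : ∀ f : ι → ℝ, ∏ l ∈ A, f l = f i * (f j * ∏ l ∈ (A.erase i).erase j, f l) :=
    fun f => by rw [Finset.mul_prod_erase _ _ hj', Finset.mul_prod_erase _ _ hi]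
  unfold edgeTerm
  rw [split, split, split, ← Finset.add_sum_erase _ _ hi, ← Finset.add_sum_erase _ _ hj',
    e1, e2, e3, e4, e5, hσi, hσj]
  ring

theorem integral_sub_add_sub {Ω : Type*} [MeasurableSpace Ω] {P : Measure Ω}
    {F₁ F₂ F₃ F₄ F₅ : Ω → ℝ} (h₁ : Integrable F₁ P) (h₂ : Integrable F₂ P) (h₃ : Integrable F₃ P)
    (h₄ : Integrable F₄ P) (h₅ : Integrable F₅ P) (k k' : ℝ) :
    (∫ ω, (F₁ ω - F₂ ω + (k * (F₃ ω - F₄ ω) - k' * F₅ ω)) ∂P) - ∫ ω, (F₁ ω - F₂ ω) ∂P =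
      k * (∫ ω, F₃ ω ∂P - ∫ ω, F₄ ω ∂P) - k' * ∫ ω, F₅ ω ∂P := by
  have h34 : Integrable (fun ω => F₃ ω - F₄ ω) P := h₃.sub h₄
  have h12 : Integrable (fun ω => F₁ ω - F₂ ω) P := h₁.sub h₂
  have hr : Integrable (fun ω => k * (F₃ ω - F₄ ω) - k' * F₅ ω) P :=
    (h34.const_mul k).sub (h₅.const_mul k')
  rw [integral_add h12 hr, add_sub_cancel_left, integral_sub (h34.const_mul k) (h₅.const_mul k'),
    integral_const_mul, integral_const_mul, integral_sub h₃ h₄]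

/-- The source is carried by configurations with an adjacent pair of labels in `A`. -/
theorem abs_source_le (hμ : IsFlow μ) (A : Finset ι) {s θ a b : ℝ} (ha : 0 ≤ a) (hb : 0 ≤ b)
    (hθ : ∀ z (l : Fin d), |dens μ s (z + Pi.single l 1) - dens μ s z| ≤ θ) (x : Tuple ι d)
    (hA : ∀ i ∈ A, ∀ j ∈ A, i ≠ j → |corr μ ((A.erase i).erase j) s x.1| ≤ a)
    (hB : ∀ i ∈ A, ∀ j ∈ A, i ≠ j → Adj i j x →
      |corr μ (A.erase j) s x.1 - corr μ (A.erase i) s x.1| ≤ b) (hθ0 : 0 ≤ θ) :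
    |source μ A s x| ≤ (2 * θ * b + θ ^ 2 * a) * ∑ p ∈ A.offDiag, adjInd p.1 p.2 x := by
  classical
  have hprob := hμ.prob
  set c := 2 * θ * b + θ ^ 2 * a with hc
  have hc0 : 0 ≤ c := by positivity
  have hl : ∀ (B : Finset ι) (z : ι → Site d) (r : ι → ℝ),
      Integrable (fun η : Config d => ∏ i ∈ B, (occ η (z i) - r i)) (μ s) :=
    fun B z r => (isLocal_centred B z r).integrable _
  -- The error of each edge is charged to the ordered pair sitting at its lower and upper endpoints;
  -- below, each pair is charged by at most one edge.
  have hedge : ∀ e ∈ edges x.1,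
      |(∫ η, edgeTerm μ A s x.1 (Equiv.swap e.1 (e.1 + Pi.single e.2 1)) η ∂μ s) -
        (corr μ A s (move e.1 e.2 x).1 - corr μ A s x.1)| ≤
      ∑ p ∈ A.offDiag, if x.1 p.1 = e.1 ∧ x.1 p.2 = e.1 + Pi.single e.2 1 then c else 0 := by
    rintro ⟨y, l⟩ -
    simp only
    set σ := Equiv.swap y (y + Pi.single l 1) with hσ
    have hnn : ∀ p ∈ A.offDiag, 0 ≤
        if x.1 p.1 = y ∧ x.1 p.2 = y + Pi.single l 1 then c else 0 := fun p _ => by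
      split_ifs <;> simp [hc0]
    have hcorr : corr μ A s (move y l x).1 - corr μ A s x.1 =
        ∫ η, (∏ l ∈ A, (occ η (σ (x.1 l)) - dens μ s (σ (x.1 l))) -
          ∏ l ∈ A, (occ η (x.1 l) - dens μ s (x.1 l))) ∂μ s := by
      rw [integral_sub (hl _ _ _) (hl _ _ _)]; rfl
    by_cases hex : ∃ i ∈ A, ∃ j ∈ A, x.1 i = y ∧ x.1 j = y + Pi.single l 1
    · obtain ⟨i, hi, j, hj, hiy, hjy⟩ := hex
      have hij : i ≠ j := by
        rintro rfl
        exact single_ne_zero l (by simpa using hiy.symm.trans hjy)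
      have hσi : σ (x.1 i) = x.1 j := by rw [hiy, hjy, hσ, Equiv.swap_apply_left]
      have hσj : σ (x.1 j) = x.1 i := by rw [hiy, hjy, hσ, Equiv.swap_apply_right]
      have hfix : ∀ l ∈ A, l ≠ i → l ≠ j → σ (x.1 l) = x.1 l := fun m _ hmi hmj =>
        Equiv.swap_apply_of_ne_of_ne (fun h => hmi (x.2 (h.trans hiy.symm)))
          fun h => hmj (x.2 (h.trans hjy.symm))
      rw [integral_congr_ae (Eventually.of_forall fun η =>
        edgeTerm_of_exchange A s x.1 σ η hi hj hij hσi hσj hfix), hcorr]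
      refine (congrArg abs (integral_sub_add_sub (hl A (fun l => σ (x.1 l))
        fun l => dens μ s (σ (x.1 l))) (hl A x.1 fun l => dens μ s (x.1 l))
        (hl (A.erase j) x.1 fun l => dens μ s (x.1 l))
        (hl (A.erase i) x.1 fun l => dens μ s (x.1 l))
        (hl ((A.erase i).erase j) x.1 fun l => dens μ s (x.1 l))
        (2 * (dens μ s (x.1 j) - dens μ s (x.1 i)))
        ((dens μ s (x.1 j) - dens μ s (x.1 i)) ^ 2))).trans_le ?_
      change |2 * (dens μ s (x.1 j) - dens μ s (x.1 i)) *
        (corr μ (A.erase j) s x.1 - corr μ (A.erase i) s x.1) -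
        (dens μ s (x.1 j) - dens μ s (x.1 i)) ^ 2 * corr μ ((A.erase i).erase j) s x.1| ≤ _
      have hδ : |dens μ s (x.1 j) - dens μ s (x.1 i)| ≤ θ := by rw [hjy, hiy]; exact hθ y l
      have h1 := hA i hi j hj hij
      have h2 := hB i hi j hj hij ⟨l, Or.inl (by rw [hiy, hjy])⟩
      refine le_trans ?_ (Finset.single_le_sum hnn
        (Finset.mem_offDiag.2 ⟨hi, hj, hij⟩ : (i, j) ∈ A.offDiag))
      rw [if_pos ⟨hiy, hjy⟩]
      refine (abs_sub _ _).trans (add_le_add ?_ ?_)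
      · rw [abs_mul, abs_mul, abs_two]
        exact mul_le_mul (mul_le_mul_of_nonneg_left hδ zero_le_two) h2 (abs_nonneg _)
          (by positivity)
      · rw [abs_mul, abs_pow]
        exact mul_le_mul (pow_le_pow_left₀ (abs_nonneg _) hδ 2) h1 (abs_nonneg _) (by positivity)
    · have hterm : ∀ η, edgeTerm μ A s x.1 σ η =
          ∏ l ∈ A, (occ η (σ (x.1 l)) - dens μ s (σ (x.1 l))) -
            ∏ l ∈ A, (occ η (x.1 l) - dens μ s (x.1 l)) := by
        intro η
        by_cases h1 : ∃ i ∈ A, x.1 i = y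
        · obtain ⟨i, hi, hiy⟩ := h1
          exact edgeTerm_of_fixed A s x.1 σ η hi fun m hm hmi => Equiv.swap_apply_of_ne_of_ne
            (fun h => hmi (x.2 (h.trans hiy.symm))) fun h => hex ⟨i, hi, m, hm, hiy, h⟩
        by_cases h2 : ∃ j ∈ A, x.1 j = y + Pi.single l 1
        · obtain ⟨j, hj, hjy⟩ := h2
          exact edgeTerm_of_fixed A s x.1 σ η hj fun m hm hmj => Equiv.swap_apply_of_ne_of_ne
            (fun h => h1 ⟨m, hm, h⟩) fun h => hmj (x.2 (h.trans hjy.symm))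
        exact edgeTerm_of_forall_fixed A s x.1 σ η fun m hm => Equiv.swap_apply_of_ne_of_ne
          (fun h => h1 ⟨m, hm, h⟩) fun h => h2 ⟨m, hm, h⟩
      rw [integral_congr_ae (Eventually.of_forall hterm), hcorr, sub_self, abs_zero]
      exact Finset.sum_nonneg hnn
  unfold source
  rw [stir_apply, ← Finset.sum_sub_distrib]
  refine (Finset.abs_sum_le_sum_abs _ _).trans ((Finset.sum_le_sum hedge).trans ?_)
  rw [Finset.sum_comm, Finset.mul_sum]
  refine Finset.sum_le_sum fun p _ => ?_
  by_cases hadj : ∃ l : Fin d, x.1 p.2 = x.1 p.1 + Pi.single l 1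
  · obtain ⟨l, hl⟩ := hadj
    rw [adjInd, if_pos ⟨l, Or.inl hl⟩, mul_one, ← Finset.sum_filter]
    have hsub : ((edges x.1).filter fun e : Site d × Fin d =>
        x.1 p.1 = e.1 ∧ x.1 p.2 = e.1 + Pi.single e.2 1) ⊆ {(x.1 p.1, l)} := by
      rintro ⟨y, l'⟩ he
      obtain ⟨-, h1, h2⟩ := Finset.mem_filter.1 he
      simp only at h1 h2
      subst h1
      have h3 : (Pi.single l 1 : Site d) = Pi.single l' 1 := add_left_cancel (hl.symm.trans h2)
      have h4 : l = l' := by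
        by_contra hne
        have := congrFun h3 l
        simp [hne] at this
      rw [h4, Finset.mem_singleton]
    calc _ ≤ ∑ _e ∈ ({(x.1 p.1, l)} : Finset (Site d × Fin d)), c :=
          Finset.sum_le_sum_of_subset_of_nonneg hsub fun _ _ _ => hc0
      _ = c := Finset.sum_singleton _ _
  · rw [Finset.sum_eq_zero fun e _ => if_neg fun h => hadj ⟨e.2, h.1 ▸ h.2⟩]
    exact mul_nonneg hc0 (adjInd_nonneg _ _ _)

end Flow

/-! ### Induction on the number of points. -/

section Recursion

variable {ι : Type*} [Fintype ι] [DecidableEq ι] {d : ℕ} {μ : ℝ → Measure (Config d)}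

theorem abs_corr_le_one (hμ : IsFlow μ) (A : Finset ι) (s : ℝ) (x : ι → Site d) :
    |corr μ A s x| ≤ 1 := by
  have hprob := hμ.prob
  have h : ∀ η : Config d, ‖∏ i ∈ A, (occ η (x i) - dens μ s (x i))‖ ≤ 1 := fun η => by
    rw [Real.norm_eq_abs, Finset.abs_prod]
    refine Finset.prod_le_one (fun _ _ => abs_nonneg _) fun i _ => ?_
    have h1 := dens_mem hμ s (x i)
    have h2 : 0 ≤ occ η (x i) ∧ occ η (x i) ≤ 1 := by unfold occ; split_ifs <;> norm_num
    exact abs_le.2 ⟨by linarith [h1.2, h2.1], by linarith [h1.1, h2.2]⟩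
  simpa [corr] using norm_integral_le_of_norm_le_const (μ := μ s) (Eventually.of_forall h)

theorem corr_empty (hμ : IsFlow μ) (s : ℝ) (x : ι → Site d) : corr μ ∅ s x = 1 := by
  have hprob := hμ.prob
  simp [corr]

theorem corr_singleton (hμ : IsFlow μ) (s : ℝ) (x : ι → Site d) (i : ι) : corr μ {i} s x = 0 := by
  have hprob := hμ.prob
  simp only [corr, Finset.prod_singleton]
  rw [integral_sub ((isLocal_occ _).integrable _) (integrable_const _)]
  simp [dens]

theorem corr_relabel {a b : ι} {A : Finset ι} (ha : a ∉ A) (hb : b ∉ A) (s : ℝ)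
    (x : Tuple ι d) : corr μ (insert a A) s (relabel a b x).1 = corr μ (insert b A) s x.1 := by
  unfold corr
  congr 1
  funext η
  rw [Finset.prod_insert ha, Finset.prod_insert hb]
  have h1 : (relabel a b x).1 a = x.1 b := congrArg x.1 (Equiv.swap_apply_left a b)
  rw [h1]
  congr 1
  refine Finset.prod_congr rfl fun i hi => ?_
  have h2 : (relabel a b x).1 i = x.1 i := congrArg x.1
    (Equiv.swap_apply_of_ne_of_ne (fun h => ha (h ▸ hi)) fun h => hb (h ▸ hi))
  rw [h2]

/-- Duhamel's bound for a source carried by adjacent pairs. -/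
theorem duhamel_adj {Λ : ℝ} {A : (Tuple ι d → ℝ) →ₗ[ℝ] (Tuple ι d → ℝ)} (hA : IsSubMarkov Λ A)
    {P : Tuple ι d → Prop} {M N c : ℝ} (hM : 0 ≤ M) (hc : 0 ≤ c)
    (hH : ∀ i j : ι, i ≠ j → ∃ H : ℝ → Tuple ι d → ℝ, IsPotential A (adjInd i j) H ∧
      ∀ s ∈ Icc 0 N, ∀ x, P x → H s x ≤ M)
    {u src : ℝ → Tuple ι d → ℝ}
    (hu : ∀ x, ∀ s ∈ Icc 0 N, HasDerivWithinAt (fun s => u s x) (A (u s) x + src s x) (Ici 0) s)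
    (hub : ∃ B, ∀ s ∈ Icc 0 N, ∀ x, |u s x| ≤ B) (hu0 : ∀ x, u 0 x = 0)
    (hsrc : ∀ s ∈ Icc 0 N, ∀ x,
      |src s x| ≤ c * ∑ p ∈ (Finset.univ : Finset ι).offDiag, adjInd p.1 p.2 x) :
    ∀ s ∈ Icc 0 N, ∀ x, P x → |u s x| ≤ c * ((Fintype.card ι : ℝ) ^ 2 * M) := by
  choose H hHp hHM using fun p : (Finset.univ : Finset ι).offDiag =>
    hH p.1.1 p.1.2 (Finset.mem_offDiag.1 p.2).2.2
  intro s hs x hx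
  refine (duhamel_bound hA Finset.univ (fun p => adjInd p.1.1 p.1.2) H (b := c)
    (fun p => (hHp p).zero) (fun p => (hHp p).deriv) (fun p => (hHp p).bdd) hu hub hu0
    (fun s hs x => (hsrc s hs x).trans (le_of_eq ?_)) s hs x).trans ?_
  · rw [Finset.sum_coe_sort _ fun p : ι × ι => adjInd p.1 p.2 x]
  · refine mul_le_mul_of_nonneg_left ?_ hc
    calc ∑ p, H p s x ≤ ∑ _p : (Finset.univ : Finset ι).offDiag, M :=
          Finset.sum_le_sum fun p _ => hHM p s hs x hx
      _ = ((Finset.univ : Finset ι).offDiag.card : ℝ) * M := by simp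
      _ ≤ _ := by
        refine mul_le_mul_of_nonneg_right ?_ hM
        rw [Finset.offDiag_card, Finset.card_univ, sq]
        exact_mod_cast Nat.sub_le _ _

/-- The order of magnitude of the `m`-point correlations. -/
noncomputable def order (α β : ℝ) (m : ℕ) : ℝ := α ^ (m / 2) * β ^ (m % 2)

theorem order_nonneg {α β : ℝ} (hα : 0 ≤ α) (hβ : 0 ≤ β) (m : ℕ) : 0 ≤ order α β m := by
  unfold order; positivity

theorem order_add_two (α β : ℝ) (m : ℕ) : order α β (m + 2) = α * order α β m := by
  unfold order
  rw [Nat.add_mod_right, Nat.add_div_right _ (by norm_num), pow_succ]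
  ring

/-- An odd order already contains a factor `β`; one more gives `β²`, which is traded for `α`. -/
theorem mul_order_le {α β : ℝ} (hα : 0 ≤ α) (h : β ^ 2 ≤ α) (m : ℕ) :
    β * order α β m ≤ order α β (m + 1) := by
  unfold order
  rcases Nat.even_or_odd' m with ⟨j, rfl | rfl⟩
  · have h1 : (2 * j + 1) / 2 = j := by omega
    have h2 : (2 * j + 1) % 2 = 1 := by omega
    have h3 : 2 * j / 2 = j := by omega
    have h4 : 2 * j % 2 = 0 := by omega
    rw [h1, h2, h3, h4]
    exact le_of_eq (by ring)
  · have h1 : (2 * j + 1) / 2 = j := by omega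
    have h2 : (2 * j + 1) % 2 = 1 := by omega
    have h3 : (2 * j + 1 + 1) / 2 = j + 1 := by omega
    have h4 : (2 * j + 1 + 1) % 2 = 0 := by omega
    rw [h1, h2, h3, h4]
    calc β * (α ^ j * β ^ 1) = α ^ j * β ^ 2 := by ring
      _ ≤ α ^ j * α := mul_le_mul_of_nonneg_left h (by positivity)
      _ = _ := by ring

/-- Bounds on all correlations and on their discrete gradients, by induction on the number of
points. -/
theorem corr_bounds (hμ : IsFlow μ) {N C α β θ : ℝ} (hC : 0 ≤ C) (hα : 0 ≤ α)
    (hβ : 0 ≤ β) (hβα : β ^ 2 ≤ α) (hpot : PotentialBound ι d C α β N) (hθ0 : 0 ≤ θ)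
    (hθ : ∀ s ∈ Icc 0 N, ∀ z (l : Fin d), |dens μ s (z + Pi.single l 1) - dens μ s z| ≤ θ)
    (h0 : ∀ A : Finset ι, A.Nonempty → ∀ x : Tuple ι d, corr μ A 0 x.1 = 0) {K : ℝ}
    (hK1 : 1 ≤ K) (hK : 6 * C * (Fintype.card ι : ℝ) ^ 2 ≤ K) (m : ℕ) :
    (∀ A : Finset ι, A.card = m → ∀ s ∈ Icc 0 N, ∀ x : Tuple ι d,
      |corr μ A s x.1| ≤ (K * θ) ^ m * order α β m) ∧
    (∀ A : Finset ι, A.card = m + 1 → ∀ s ∈ Icc 0 N, ∀ x : Tuple ι d,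
      |corr μ A s x.1| ≤ (K * θ) ^ (m + 1) * order α β (m + 1)) ∧
    (∀ A : Finset ι, A.card = m → ∀ a b, a ≠ b → a ∉ A → b ∉ A → ∀ s ∈ Icc 0 N,
      ∀ x : Tuple ι d, Adj a b x →
      |corr μ (insert a A) s x.1 - corr μ (insert b A) s x.1| ≤
        (K * θ) ^ (m + 1) * order α β m) := by
  have hK0 : 0 ≤ K := zero_le_one.trans hK1
  induction m with
  | zero =>
    refine ⟨fun A hA s _ x => ?_, fun A hA s _ x => ?_, fun A hA a b _ _ _ s _ x _ => ?_⟩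
    · rw [Finset.card_eq_zero.1 hA, corr_empty hμ]
      simp [order]
    · obtain ⟨i, rfl⟩ := Finset.card_eq_one.1 hA
      rw [corr_singleton hμ, abs_zero]
      exact mul_nonneg (by positivity) (order_nonneg hα hβ _)
    · rw [Finset.card_eq_zero.1 hA]
      simp only [insert_empty_eq]
      rw [corr_singleton hμ, corr_singleton hμ, sub_zero, abs_zero]
      exact mul_nonneg (by positivity) (order_nonneg hα hβ _)
  | succ m ih =>
    obtain ⟨ih1, ih2, ih3⟩ := ih
    have hom := order_nonneg hα hβ m
    -- The source consists of `2θ` times a difference and `θ²` times an `m`-point correlation; since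
    -- `K ≥ 1` the latter is at most `θ` times the bound on the difference, whence `3`.
    set c : ℝ := 3 * θ * ((K * θ) ^ (m + 1) * order α β m) with hc
    have hc0 : 0 ≤ c := by positivity
    have hsource : ∀ A : Finset ι, A.card = m + 2 → ∀ s ∈ Icc 0 N, ∀ x : Tuple ι d,
        |source μ A s x| ≤ c * ∑ p ∈ (Finset.univ : Finset ι).offDiag, adjInd p.1 p.2 x := by
      intro A hA s hs x
      have hcard : ∀ i ∈ A, ∀ j ∈ A, i ≠ j → ((A.erase i).erase j).card = m := by
        intro i hi j hj hij
        rw [Finset.card_erase_of_mem (Finset.mem_erase.2 ⟨hij.symm, hj⟩),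
          Finset.card_erase_of_mem hi, hA]
        omega
      refine (abs_source_le hμ A (a := (K * θ) ^ m * order α β m)
        (b := (K * θ) ^ (m + 1) * order α β m) (by positivity) (by positivity) (hθ s hs) x
        (fun i hi j hj hij => ih1 _ (hcard i hi j hj hij) s hs x)
        (fun i hi j hj hij hadj => ?_) hθ0).trans ?_
      · have hj' : j ∈ A.erase i := Finset.mem_erase.2 ⟨hij.symm, hj⟩
        have hi' : i ∈ A.erase j := Finset.mem_erase.2 ⟨hij, hi⟩
        have e1 : A.erase i = insert j ((A.erase i).erase j) := (Finset.insert_erase hj').symm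
        have e2 : A.erase j = insert i ((A.erase i).erase j) := by
          rw [Finset.erase_right_comm, Finset.insert_erase hi']
        have h := ih3 _ (hcard i hi j hj hij) i j hij (by simp) (by simp) s hs x hadj
        rwa [← e1, ← e2] at h
      · refine mul_le_mul ?_ (Finset.sum_le_sum_of_subset_of_nonneg
          (Finset.offDiag_mono (Finset.subset_univ A)) fun p _ _ => adjInd_nonneg _ _ _)
          (Finset.sum_nonneg fun p _ => adjInd_nonneg _ _ _) hc0
        have h1 : θ ^ 2 * ((K * θ) ^ m * order α β m) ≤
            θ * ((K * θ) ^ (m + 1) * order α β m) := by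
          have h2 : θ * ((K * θ) ^ (m + 1) * order α β m) =
              K * (θ ^ 2 * ((K * θ) ^ m * order α β m)) := by ring
          rw [h2]
          exact le_mul_of_one_le_left (by positivity) hK1
        rw [hc]
        linarith
    -- The factor 2 allows for the two sources in a difference; with the `3` in `c` it makes the `6`
    -- required of `K`.
    have hfinal : ∀ γ : ℝ, 0 ≤ γ → 2 * c * ((Fintype.card ι : ℝ) ^ 2 * (C * γ)) ≤
        (K * θ) ^ (m + 1 + 1) * (γ * order α β m) := by
      intro γ hγ
      calc 2 * c * ((Fintype.card ι : ℝ) ^ 2 * (C * γ)) =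
          6 * C * (Fintype.card ι : ℝ) ^ 2 * (θ * (K * θ) ^ (m + 1) * (γ * order α β m)) := by
            rw [hc]; ring
        _ ≤ K * (θ * (K * θ) ^ (m + 1) * (γ * order α β m)) :=
            mul_le_mul_of_nonneg_right hK (by positivity)
        _ = _ := by ring
    refine ⟨ih2, fun A hA s hs x => ?_, fun A hA a b hab ha hb s hs x hx => ?_⟩
    · have h := duhamel_adj (P := fun _ => True) isSubMarkov_stir (mul_nonneg hC hα) hc0
        (fun i j hij => by
          obtain ⟨H, hH, hle⟩ := hpot.stir_le i j hij
          exact ⟨H, hH, fun s hs x _ => hle s hs x⟩)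
        (u := fun s x => corr μ A s x.1) (fun x s hs => hμ.corr_ode A x hs.1)
        ⟨1, fun s _ x => abs_corr_le_one hμ A s x.1⟩
        (h0 A (Finset.card_pos.1 (by omega))) (hsource A hA) s hs x trivial
      have h2 := hfinal α hα
      have h3 : 0 ≤ c * ((Fintype.card ι : ℝ) ^ 2 * (C * α)) := by positivity
      rw [← order_add_two] at h2
      exact h.trans (by linarith)
    · have hia : (insert a A).card = m + 2 := by rw [Finset.card_insert_of_notMem ha, hA]
      have hib : (insert b A).card = m + 2 := by rw [Finset.card_insert_of_notMem hb, hA]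
      have h := duhamel_adj (P := fun x => Adj a b x) (isSubMarkov_killed a b)
        (mul_nonneg hC hβ) (mul_nonneg zero_le_two hc0)
        (fun i j hij => hpot.killed_le a b i j hab hij)
        (u := fun s x => corr μ (insert a A) s x.1 - corr μ (insert b A) s x.1)
        (src := fun s x => source μ (insert a A) s x - source μ (insert b A) s x)
        (fun x s hs => by
          refine ((hμ.corr_ode (insert a A) x hs.1).sub
            (hμ.corr_ode (insert b A) x hs.1)).congr_deriv ?_
          have e : (fun x : Tuple ι d => corr μ (insert a A) s x.1 - corr μ (insert b A) s x.1) =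
            (fun x : Tuple ι d => corr μ (insert a A) s x.1) -
              fun x : Tuple ι d => corr μ (insert b A) s x.1 := rfl
          -- Relabelling interchanges the two correlations, so their difference `G` satisfies `G ∘
          -- relabel + G = 0` and `killed` agrees with `stir` on it.
          have h1 : corr μ (insert b A) s (relabel a b x).1 = corr μ (insert a A) s x.1 := by
            have := corr_relabel (μ := μ) hb ha s x
            rwa [show relabel b a x = relabel a b x from Subtype.ext (by
              simp only [relabel, Equiv.swap_comm])] at this
          rw [killed_apply, e, map_sub]
          simp only [Pi.sub_apply]
          rw [corr_relabel ha hb, h1]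
          ring)
        ⟨2, fun s _ x => (abs_sub _ _).trans (by
          linarith [abs_corr_le_one hμ (insert a A) s x.1, abs_corr_le_one hμ (insert b A) s x.1])⟩
        (fun x => by rw [h0 _ (Finset.insert_nonempty a A), h0 _ (Finset.insert_nonempty b A),
          sub_zero])
        (fun s hs x => by
          refine (abs_sub _ _).trans ?_
          linarith [hsource _ hia s hs x, hsource _ hib s hs x]) s hs x hx
      refine h.trans ((hfinal β hβ).trans ?_)
      exact mul_le_mul_of_nonneg_left (mul_order_le hα hβα m) (by positivity)

end Recursion

/-! ### From the martingale problem to the forward equation in microscopic time. -/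

section Law

variable {d : ℕ}

theorem tendsto_floor_right (t : ℝ≥0) :
    Tendsto (fun m : ℕ => ((⌊t * (m + 1)⌋₊ + 1 : ℕ) : ℝ≥0) / (m + 1)) atTop (𝓝[≥] t) := by
  have h1 : ∀ m : ℕ, t ≤ ((⌊t * (m + 1)⌋₊ + 1 : ℕ) : ℝ≥0) / (m + 1) := fun m => by
    rw [le_div_iff₀ (by positivity)]
    push_cast
    exact (Nat.lt_floor_add_one _).le
  have h2 : ∀ m : ℕ, ((⌊t * (m + 1)⌋₊ + 1 : ℕ) : ℝ≥0) / (m + 1) ≤ t + 1 / (m + 1) := fun m => by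
    push_cast
    rw [add_div]
    gcongr
    rw [div_le_iff₀ (by positivity)]
    exact Nat.floor_le (by positivity)
  refine tendsto_nhdsWithin_iff.2 ⟨?_, Eventually.of_forall h1⟩
  refine tendsto_of_tendsto_of_tendsto_of_le_of_le tendsto_const_nhds ?_ h1 h2
  have h3 : Tendsto (fun m : ℕ => (1 / (m + 1) : ℝ≥0)) atTop (𝓝 0) := by
    rw [← NNReal.tendsto_coe]
    push_cast
    exact tendsto_one_div_add_atTop_nhds_zero_nat
  simpa using h3.const_add t

/-- Right continuity makes the evaluation a limit of evaluations at grid times to the right of `t`,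
each of which takes countably many values and is jointly measurable. -/
theorem measurable_eval_path {f : Config d → ℝ} (hf : IsLocal f) :
    Measurable fun p : ℝ × Path d => f (coord p.1.toNNReal p.2) := by
  have hm : ∀ m : ℕ, Measurable fun p : ℝ × Path d =>
      f (coord (((⌊p.1.toNNReal * (m + 1)⌋₊ + 1 : ℕ) : ℝ≥0) / (m + 1)) p.2) := by
    intro m
    have h1 : Measurable fun q : ℕ × Path d => f (coord (((q.1 + 1 : ℕ) : ℝ≥0) / (m + 1)) q.2) :=
      measurable_from_prod_countable_right fun k =>
        (hf.measurable.comp (measurable_coord (((k + 1 : ℕ) : ℝ≥0) / (m + 1))) :)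
    have h2 : Measurable fun p : ℝ × Path d => (⌊p.1.toNNReal * (m + 1)⌋₊, p.2) :=
      (Nat.measurable_floor.comp
        ((measurable_real_toNNReal.comp measurable_fst).mul_const _)).prodMk measurable_snd
    exact h1.comp h2
  refine measurable_of_tendsto_metrizable hm (tendsto_pi_nhds.2 fun p => ?_)
  exact (hf.continuous.tendsto _).comp
    ((p.2.2 p.1.toNNReal).1.tendsto.comp (tendsto_floor_right _))

/-- Expectation of a function of the configuration at a real time. -/
noncomputable def expect (P : Measure (Path d)) (f : Config d → ℝ) (t : ℝ) : ℝ :=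
  ∫ w, f (coord t.toNNReal w) ∂P

variable {n : ℕ} {ν : Measure (Config d)} {P : Measure (Path d)}

theorem integrable_coord [IsFiniteMeasure P] {f : Config d → ℝ} (hf : IsLocal f) (t : ℝ≥0) :
    Integrable (fun w => f (coord t w)) P := by
  obtain ⟨B, hB⟩ := hf.exists_bound
  exact Integrable.of_bound (hf.measurable.comp (measurable_coord t)).aestronglyMeasurable B
    (Eventually.of_forall fun w => hB _)

/-- Dynkin's process has constant mean, equal to its value 0 at time 0; Fubini moves the expectation
inside the time integral. -/
theorem IsLaw.expect_eq (hP : IsLaw n ν P) {f : Config d → ℝ} (hf : IsLocal f) {t : ℝ}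
    (ht : 0 ≤ t) :
    expect P f t = expect P f 0 + ∫ s in (0 : ℝ)..t, (n : ℝ) ^ 2 * expect P (gen f) s := by
  have hprob := hP.isProbabilityMeasure
  have hmart := (hP.martingale f hf).setIntegral_eq (zero_le (a := t.toNNReal)) MeasurableSet.univ
  rw [setIntegral_univ, setIntegral_univ] at hmart
  have h0 : ∫ w, dynkin n f 0 w ∂P = 0 := by simp [dynkin]
  obtain ⟨B, hB⟩ := hf.gen.exists_bound
  have hint : Integrable (fun p : Path d × ℝ => (n : ℝ) ^ 2 * gen f (coord p.2.toNNReal p.1))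
      (P.prod (volume.restrict (Ioc 0 t))) := by
    refine Integrable.of_bound
      (((measurable_eval_path hf.gen).comp measurable_swap).const_mul _).aestronglyMeasurable
      ((n : ℝ) ^ 2 * B) (Eventually.of_forall fun p => ?_)
    rw [norm_mul, Real.norm_of_nonneg (by positivity)]
    exact mul_le_mul_of_nonneg_left (hB _) (by positivity)
  have hswap : ∫ w, (∫ s in (0 : ℝ)..t, (n : ℝ) ^ 2 * gen f (coord s.toNNReal w)) ∂P =
      ∫ s in (0 : ℝ)..t, (n : ℝ) ^ 2 * expect P (gen f) s := by
    simp only [intervalIntegral.integral_of_le ht]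
    rw [integral_integral_swap hint]
    simp only [integral_const_mul, expect]
  have hint' : Integrable
      (fun w => ∫ s in (0 : ℝ)..t, (n : ℝ) ^ 2 * gen f (coord s.toNNReal w)) P := by
    simp only [intervalIntegral.integral_of_le ht]
    exact hint.integral_prod_left
  have hd : ∫ w, dynkin n f t.toNNReal w ∂P = expect P f t - expect P f 0 -
      ∫ s in (0 : ℝ)..t, (n : ℝ) ^ 2 * expect P (gen f) s := by
    rw [← hswap]
    simp only [dynkin, Real.coe_toNNReal t ht]
    have h1 := integrable_coord (P := P) hf t.toNNReal
    have h2 := integrable_coord (P := P) hf 0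
    have h12 : Integrable (fun w => f (coord t.toNNReal w) - f (coord 0 w)) P := h1.sub h2
    rw [integral_sub h12 hint', integral_sub h1 h2]
    simp [expect]
  linarith

theorem measurable_expect [SFinite P] {f : Config d → ℝ} (hf : IsLocal f) :
    Measurable (expect P f) :=
  ((measurable_eval_path hf).stronglyMeasurable.integral_prod_right').measurable

theorem intervalIntegrable_expect [IsProbabilityMeasure P] {f : Config d → ℝ} (hf : IsLocal f)
    (c a b : ℝ) : IntervalIntegrable (fun s => c * expect P f s) volume a b := by
  obtain ⟨B, hB⟩ := hf.exists_bound
  refine IntervalIntegrable.const_mul ?_ c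
  refine (intervalIntegrable_const (c := B)).mono_fun
    (measurable_expect hf).aestronglyMeasurable (Eventually.of_forall fun s => ?_)
  have h : ‖expect P f s‖ ≤ B := by
    simpa [expect] using norm_integral_le_of_norm_le_const (μ := P)
      (f := fun w => f (coord s.toNNReal w)) (Eventually.of_forall fun w => hB _)
  exact h.trans (le_abs_self B)

/-- Expectations are integrals of bounded functions of time, hence continuous; applied to `gen f`,
this makes the integrated equation differentiable. -/
theorem IsLaw.continuous_expect (hP : IsLaw n ν P) {f : Config d → ℝ} (hf : IsLocal f) :
    Continuous (expect P f) := by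
  have hprob := hP.isProbabilityMeasure
  have h1 : Continuous fun t : ℝ =>
      expect P f 0 + ∫ s in (0 : ℝ)..t, (n : ℝ) ^ 2 * expect P (gen f) s :=
    continuous_const.add (intervalIntegral.continuous_primitive
      (fun a b => intervalIntegrable_expect hf.gen _ a b) 0)
  have h2 : expect P f = fun t => expect P f 0 +
      ∫ s in (0 : ℝ)..(max t 0), (n : ℝ) ^ 2 * expect P (gen f) s := by
    funext t
    rw [← hP.expect_eq hf (le_max_right t 0)]
    unfold expect
    have : (max t 0).toNNReal = t.toNNReal := by
      ext; simp [Real.coe_toNNReal']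
    rw [this]
  rw [h2]
  exact h1.comp (continuous_id.max continuous_const)

/-- The one-time laws of the process in microscopic time. -/
noncomputable def law (n : ℕ) (P : Measure (Path d)) (s : ℝ) : Measure (Config d) :=
  P.map (coord (s / (n : ℝ) ^ 2).toNNReal)

theorem integral_law {f : Config d → ℝ} (hf : IsLocal f) (s : ℝ) :
    ∫ η, f η ∂law n P s = expect P f (s / (n : ℝ) ^ 2) :=
  integral_map (measurable_coord _).aemeasurable hf.measurable.aestronglyMeasurable

theorem IsLaw.isFlow (hn : 1 ≤ n) (hP : IsLaw n ν P) : IsFlow (law n P) := by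
  have hprob := hP.isProbabilityMeasure
  refine ⟨fun s => Measure.isProbabilityMeasure_map (measurable_coord _).aemeasurable,
    fun f hf s hs => ?_⟩
  have hn0 : (0 : ℝ) < (n : ℝ) ^ 2 := by
    have : (0 : ℝ) < n := by exact_mod_cast hn
    positivity
  rw [integral_law hf.gen]
  have hG : Continuous fun s => (n : ℝ) ^ 2 * expect P (gen f) s :=
    continuous_const.mul (hP.continuous_expect hf.gen)
  have h1 : HasDerivAt (fun t => expect P f 0 +
      ∫ s in (0 : ℝ)..t, (n : ℝ) ^ 2 * expect P (gen f) s)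
      ((n : ℝ) ^ 2 * expect P (gen f) (s / (n : ℝ) ^ 2)) (s / (n : ℝ) ^ 2) :=
    (intervalIntegral.integral_hasDerivAt_right (hG.intervalIntegrable _ _)
      (hG.stronglyMeasurableAtFilter _ _) hG.continuousAt).const_add _
  have h2 : HasDerivAt (fun s : ℝ => s / (n : ℝ) ^ 2) (1 / (n : ℝ) ^ 2) s :=
    (hasDerivAt_id s).div_const _
  have h3 := (h1.comp s h2).hasDerivWithinAt (s := Ici 0)
  refine (h3.congr (fun r hr => ?_) ?_).congr_deriv (by field_simp)
  · rw [integral_law hf, hP.expect_eq hf (div_nonneg hr hn0.le)]; rfl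
  · rw [integral_law hf, hP.expect_eq hf (div_nonneg hs hn0.le)]; rfl

theorem law_mul (hn : 1 ≤ n) (P : Measure (Path d)) (t : ℝ≥0) :
    law n P ((n : ℝ) ^ 2 * t) = P.map (coord t) := by
  have : (n : ℝ) ≠ 0 := by exact_mod_cast (by omega : n ≠ 0)
  rw [law, mul_div_cancel_left₀ _ (pow_ne_zero 2 this), Real.toNNReal_coe]

theorem correlation_eq_corr (hn : 1 ≤ n) (P : Measure (Path d)) (t : ℝ≥0) {k : ℕ}
    (x : Fin k → Site d) :
    correlation P (fun _ => t) x = corr (law n P) Finset.univ ((n : ℝ) ^ 2 * t) x := by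
  have hd : ∀ z, dens (law n P) ((n : ℝ) ^ 2 * t) z = density P t z := fun z => by
    rw [dens, law_mul hn, integral_map (measurable_coord t).aemeasurable
      (isLocal_occ z).measurable.aestronglyMeasurable, density]
  unfold corr correlation
  simp only [hd]
  rw [law_mul hn, integral_map (measurable_coord t).aemeasurable
    (isLocal_centred Finset.univ x fun i => density P t (x i)).measurable.aestronglyMeasurable]

end Law

/-! ### The product initial measure. -/

section Initial

variable {d : ℕ}

instance (ρ₀ : EuclideanSpace ℝ (Fin d) → unitInterval) (n : ℕ) :
    IsProbabilityMeasure (initialMeasure ρ₀ n) := by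
  unfold initialMeasure; infer_instance

theorem integral_occ_initialMeasure (ρ₀ : EuclideanSpace ℝ (Fin d) → unitInterval) (n : ℕ)
    (z : Site d) : ∫ η, occ η z ∂initialMeasure ρ₀ n = ρ₀ (rescale n z) := by
  have h := integral_map (μ := initialMeasure ρ₀ n) (φ := fun η : Config d => η z)
    (measurable_pi_apply z).aemeasurable
    (f := fun b : Bool => if b then (1 : ℝ) else 0) Measurable.of_discrete.aestronglyMeasurable
  unfold initialMeasure at h ⊢
  rw [Measure.infinitePi_map_eval] at h
  refine Eq.trans h.symm ?_
  rw [bernoulliMeasure, integral_add_measure (by simp) (by simp)]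
  simp only [Bool.false_eq_true, integral_smul_nnreal_measure, integral_dirac, if_true, if_false,
    smul_zero, add_zero, NNReal.smul_def, smul_eq_mul, mul_one]
  rfl

/-- Distinct sites are independent, so the expectation factorises, and every factor is centred. -/
theorem corr_initial {ι : Type*} [Fintype ι] [DecidableEq ι] {μ : ℝ → Measure (Config d)}
    {ρ₀ : EuclideanSpace ℝ (Fin d) → unitInterval} {n : ℕ} (h0 : μ 0 = initialMeasure ρ₀ n)
    {A : Finset ι} (hA : A.Nonempty) (x : Tuple ι d) : corr μ A 0 x.1 = 0 := by
  unfold corr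
  set r : Site d → ℝ := dens μ 0 with hr
  rw [h0]
  have hind : iIndepFun (fun (z : Site d) (η : Config d) => occ η z - r z)
      (initialMeasure ρ₀ n) :=
    iIndepFun_infinitePi (X := fun z (b : Bool) => (if b then (1 : ℝ) else 0) - r z)
      fun z => Measurable.of_discrete
  have hind' := hind.precomp (g := fun i : A => x.1 i)
    (x.2.comp Subtype.val_injective)
  have h1 := hind'.integral_prod_eq_prod_integral
    fun i => ((isLocal_occ _).sub (IsLocal.const _)).measurable.aestronglyMeasurable
  have h2 : ∀ η : Config d, ∏ i ∈ A, (occ η (x.1 i) - r (x.1 i)) =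
      (∏ i : A, fun η : Config d => occ η (x.1 i) - r (x.1 i)) η := fun η => by
    rw [Finset.prod_apply, Finset.prod_coe_sort A fun i => occ η (x.1 i) - r (x.1 i)]
  simp only [h2]
  refine h1.trans ?_
  obtain ⟨i, hi⟩ := hA
  refine Finset.prod_eq_zero (Finset.mem_univ (⟨i, hi⟩ : A)) ?_
  rw [integral_sub ((isLocal_occ _).integrable _) (integrable_const _), hr, dens, h0]
  simp

end Initial

/-! ### Lipschitz bound for the initial profile. -/

section Gradient

theorem le_taylor_four {g₀ g₁ g₂ g₃ g₄ : ℝ → ℝ} (h₀ : ∀ s, HasDerivAt g₀ (g₁ s) s)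
    (h₁ : ∀ s, HasDerivAt g₁ (g₂ s) s) (h₂ : ∀ s, HasDerivAt g₂ (g₃ s) s)
    (h₃ : ∀ s, HasDerivAt g₃ (g₄ s) s) {K : ℝ} (hK : ∀ s, g₄ s ≤ K) {s : ℝ} (hs : 0 ≤ s) :
    g₀ s ≤ g₀ 0 + g₁ 0 * s + g₂ 0 * s ^ 2 / 2 + g₃ 0 * s ^ 3 / 6 + K * s ^ 4 / 24 := by
  have p : ∀ (c : ℝ) (m : ℕ) (r : ℝ), HasDerivAt (fun s => c * s ^ m) (c * (m * r ^ (m - 1))) r :=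
    fun c m r => (hasDerivAt_pow m r).const_mul c
  have i3 := le_of_deriv_le (T := s) (g := fun s => g₃ 0 + K * s ^ 1) (fun r _ => h₃ r)
    (fun r _ => (p K 1 r).const_add _) (by simp) (fun r _ => by simpa using hK r)
  have i2 := le_of_deriv_le (T := s) (g := fun s => g₂ 0 + g₃ 0 * s ^ 1 + K / 2 * s ^ 2)
    (fun r _ => h₂ r) (fun r _ => ((p _ 1 r).const_add _).add (p _ 2 r)) (by simp)
    (fun r hr => (i3 r hr).trans (le_of_eq (by push_cast; ring)))
  have i1 := le_of_deriv_le (T := s)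
    (g := fun s => g₁ 0 + g₂ 0 * s ^ 1 + g₃ 0 / 2 * s ^ 2 + K / 6 * s ^ 3)
    (fun r _ => h₁ r) (fun r _ => (((p _ 1 r).const_add _).add (p _ 2 r)).add (p _ 3 r)) (by simp)
    (fun r hr => (i2 r hr).trans (le_of_eq (by push_cast; ring)))
  have i0 := le_of_deriv_le (T := s)
    (g := fun s => g₀ 0 + g₁ 0 * s ^ 1 + g₂ 0 / 2 * s ^ 2 + g₃ 0 / 6 * s ^ 3 + K / 24 * s ^ 4)
    (fun r _ => h₀ r) (fun r _ => ((((p _ 1 r).const_add _).add (p _ 2 r)).add (p _ 3 r)).add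
      (p _ 4 r)) (by simp)
    (fun r hr => (i1 r hr).trans (le_of_eq (by push_cast; ring)))
  refine (i0 s ⟨hs, le_rfl⟩).trans (le_of_eq (by ring))

/-- A function with values in `[0,1]` and bounded fourth derivative has bounded derivative. -/
theorem abs_deriv_le_of_fourth {g₀ g₁ g₂ g₃ g₄ : ℝ → ℝ} (h₀ : ∀ s, HasDerivAt g₀ (g₁ s) s)
    (h₁ : ∀ s, HasDerivAt g₁ (g₂ s) s) (h₂ : ∀ s, HasDerivAt g₂ (g₃ s) s)
    (h₃ : ∀ s, HasDerivAt g₃ (g₄ s) s) {K : ℝ} (hK : ∀ s, |g₄ s| ≤ K)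
    (hg : ∀ s, g₀ s ∈ Icc (0 : ℝ) 1) : |g₁ 0| ≤ 5 + 3 * K := by
  have up : ∀ s : ℝ, 0 ≤ s → _ := fun s hs => le_taylor_four h₀ h₁ h₂ h₃
    (fun s => (abs_le.1 (hK s)).2) (s := s) hs
  have lo : ∀ s : ℝ, 0 ≤ s → _ := fun s hs => le_taylor_four (fun s => (h₀ s).neg)
    (fun s => (h₁ s).neg) (fun s => (h₂ s).neg) (fun s => (h₃ s).neg)
    (fun s => neg_le.1 (abs_le.1 (hK s)).1) (s := s) hs
  have hK0 : 0 ≤ K := (abs_nonneg _).trans (hK 0)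
  -- The combination `18g(1) - 9g(2) + 2g(3) - 11g(0)` equals `6g'(0)` up to the fourth-order
  -- remainder: the second and third derivatives at 0, which are not controlled, drop out.
  have u1 := up 1 (by norm_num)
  have u2 := up 2 (by norm_num)
  have u3 := up 3 (by norm_num)
  have l1 := lo 1 (by norm_num)
  have l2 := lo 2 (by norm_num)
  have l3 := lo 3 (by norm_num)
  simp only [Pi.neg_apply] at l1 l2 l3
  have b0 := hg 0
  have b1 := hg 1
  have b2 := hg 2
  have b3 := hg 3
  simp only [mem_Icc] at b0 b1 b2 b3
  rw [abs_le]
  constructor <;> linarith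

theorem HasBoundedFourthDeriv.exists_lipschitz {E : Type*} [NormedAddCommGroup E]
    [NormedSpace ℝ E] {F : E → ℝ} (hF : HasBoundedFourthDeriv F) (h01 : ∀ u, F u ∈ Icc (0 : ℝ) 1) :
    ∃ L, 0 ≤ L ∧ ∀ (u e : E), ‖e‖ ≤ 1 → ∀ s, 0 ≤ s → |F (u + s • e) - F u| ≤ L * s := by
  obtain ⟨h3, h4, K, hK⟩ := hF
  have hK0 : 0 ≤ K := (norm_nonneg _).trans (hK 0)
  have hdiff : ∀ m : ℕ, m ≤ 3 → Differentiable ℝ (iteratedFDeriv ℝ m F) := by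
    intro m hm
    rcases hm.lt_or_eq with h | rfl
    · exact h3.differentiable_iteratedFDeriv (by exact_mod_cast h)
    · exact h4
  have hder : ∀ m : ℕ, m ≤ 3 → ∀ u e : E, ∀ s : ℝ,
      HasDerivAt (fun s : ℝ => iteratedFDeriv ℝ m F (u + s • e) fun _ => e)
        (iteratedFDeriv ℝ (m + 1) F (u + s • e) fun _ => e) s := by
    intro m hm u e s
    have h1 : HasDerivAt (fun s : ℝ => u + s • e) e s := by
      simpa using ((hasDerivAt_id s).smul_const e).const_add u
    have h2 := (hdiff m hm (u + s • e)).hasFDerivAt.comp_hasDerivAt s h1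
    have h5 := (ContinuousMultilinearMap.apply ℝ (fun _ : Fin m => E) ℝ
      (fun _ => e)).hasFDerivAt.comp_hasDerivAt s h2
    rw [iteratedFDeriv_succ_apply_left]
    exact h5
  have hg1 : ∀ u e : E, ‖e‖ ≤ 1 → |iteratedFDeriv ℝ 1 F u fun _ => e| ≤ 5 + 3 * K := by
    intro u e he
    have h := abs_deriv_le_of_fourth (hder 0 (by norm_num) u e) (hder 1 (by norm_num) u e)
      (hder 2 (by norm_num) u e) (hder 3 le_rfl u e) (K := K) (fun s => ?_) (fun s => ?_)
    · simpa using h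
    · refine ((iteratedFDeriv ℝ 4 F (u + s • e)).le_opNorm _).trans ?_
      calc _ ≤ K * 1 := mul_le_mul (hK _)
            (Finset.prod_le_one (fun _ _ => norm_nonneg _) fun _ _ => he)
            (Finset.prod_nonneg fun _ _ => norm_nonneg _) hK0
        _ = K := mul_one K
    · simpa using h01 (u + s • e)
  refine ⟨5 + 3 * K, by positivity, fun u e he s hs => ?_⟩
  have h := Convex.norm_image_sub_le_of_norm_hasDerivWithin_le (s := univ) (x := 0) (y := s)
    (fun r _ => (hder 0 (by norm_num) u e r).hasDerivWithinAt)
    (fun r _ => hg1 (u + r • e) e he) convex_univ (mem_univ _) (mem_univ _)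
  simpa [abs_of_nonneg hs] using h

theorem exists_profile_gradient {d : ℕ} {ρ₀ : EuclideanSpace ℝ (Fin d) → unitInterval}
    (hρ₀ : HasBoundedFourthDeriv fun u => (ρ₀ u : ℝ)) :
    ∃ L, 0 ≤ L ∧ ∀ n : ℕ, 1 ≤ n → ∀ (z : Site d) (l : Fin d),
      |(ρ₀ (rescale n (z + Pi.single l 1)) : ℝ) - ρ₀ (rescale n z)| ≤ L / n := by
  obtain ⟨L, hL0, hL⟩ := hρ₀.exists_lipschitz fun u => (ρ₀ u).2
  refine ⟨L, hL0, fun n hn z l => ?_⟩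
  have h1 : rescale n (z + Pi.single l 1) =
      rescale n z + ((1 : ℝ) / n) • EuclideanSpace.single l (1 : ℝ) := by
    ext i
    by_cases h : i = l
    · subst h; simp [rescale]; ring
    · simp [rescale, h]
  rw [h1, div_eq_mul_one_div L]
  exact hL _ _ (by simp) _ (by positivity)

end Gradient

/-! ### Assembly of the bounds. -/

section Main

theorem log_one_add_sq_le {y : ℝ} (hy : 0 ≤ y) : Real.log (1 + y) ^ 2 ≤ y := by
  -- With `r = √y`, the cubic Taylor sum of `e^r` exceeds `1 + r²` by `r(r² - 3r + 6)/6`, and the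
  -- quadratic is positive.
  have h1 : 1 + √y ^ 2 ≤ Real.exp √y := by
    have h2 := Real.sum_le_exp_of_nonneg (Real.sqrt_nonneg y) 4
    simp only [Finset.sum_range_succ, Finset.sum_range_zero, Nat.factorial] at h2
    push_cast at h2
    have h3 := Real.sqrt_nonneg y
    nlinarith [mul_nonneg h3 (sq_nonneg (√y - 3 / 2))]
  rw [Real.sq_sqrt hy] at h1
  have h4 : Real.log (1 + y) ≤ √y := (Real.log_le_iff_le_exp (by linarith)).2 h1
  calc Real.log (1 + y) ^ 2 ≤ √y ^ 2 := pow_le_pow_left₀ (Real.log_nonneg (by linarith)) h4 2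
    _ = y := Real.sq_sqrt hy

/-- Potential bounds for all horizons give bounds on the correlations of the process. -/
theorem correlation_le {d k : ℕ} {ρ₀ : EuclideanSpace ℝ (Fin d) → unitInterval}
    (hρ₀ : HasBoundedFourthDeriv fun u => (ρ₀ u : ℝ)) {C₀ : ℝ} (hC₀ : 0 ≤ C₀) {α β : ℝ → ℝ}
    (hα : ∀ N, 0 ≤ N → 0 ≤ α N) (hβ : ∀ N, 0 ≤ N → 0 ≤ β N)
    (hβα : ∀ N, 0 ≤ N → β N ^ 2 ≤ α N)
    (hpot : ∀ N, 0 ≤ N → PotentialBound (Fin k) d C₀ (α N) (β N) N) :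
    ∃ C : ℝ, 0 ≤ C ∧ ∀ n : ℕ, 1 ≤ n → ∀ P : Measure (Path d),
      IsLaw n (initialMeasure ρ₀ n) P →
      ∀ t : ℝ≥0, ∀ x : Fin k → Site d, Function.Injective x →
        |correlation P (fun _ => t) x| ≤ C / (n : ℝ) ^ k *
          (α ((n : ℝ) ^ 2 * t) ^ (k / 2) * β ((n : ℝ) ^ 2 * t) ^ (k % 2)) := by
  obtain ⟨L, hL0, hL⟩ := exists_profile_gradient hρ₀
  set K : ℝ := 6 * C₀ * (Fintype.card (Fin k) : ℝ) ^ 2 + 1 with hK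
  have hK1 : 1 ≤ K := by
    have : 0 ≤ 6 * C₀ * (Fintype.card (Fin k) : ℝ) ^ 2 := by positivity
    linarith
  refine ⟨(K * L) ^ k, by positivity, fun n hn P hP t x hx => ?_⟩
  have hflow := hP.isFlow hn
  have h0 : law n P 0 = initialMeasure ρ₀ n := by
    rw [law, zero_div, Real.toNNReal_zero]; exact hP.initial
  set N : ℝ := (n : ℝ) ^ 2 * t with hN
  have hN0 : 0 ≤ N := by positivity
  have hgrad : ∀ z (l : Fin d),
      |dens (law n P) 0 (z + Pi.single l 1) - dens (law n P) 0 z| ≤ L / n := fun z l => by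
    rw [dens, dens, h0, integral_occ_initialMeasure, integral_occ_initialMeasure]
    exact hL n hn z l
  have h := (corr_bounds hflow (θ := L / n) hC₀ (hα N hN0) (hβ N hN0) (hβα N hN0) (hpot N hN0)
    (by positivity) (fun s hs z l => hflow.gradient_le hgrad hs.1 z l)
    (fun A hA x => corr_initial h0 hA x) hK1 (by rw [hK]; linarith) k).1 Finset.univ
    (by simp) N ⟨hN0, le_rfl⟩ ⟨x, hx⟩
  rw [correlation_eq_corr hn]
  refine h.trans (le_of_eq ?_)
  rw [order, ← mul_div_assoc, div_pow]

end Main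

end SSEP

theorem lemma3p1 (d k : ℕ) (hk : 2 ≤ k) (T : ℝ) (hT : 0 < T)
    (ρ₀ : EuclideanSpace ℝ (Fin d) → unitInterval)
    (hρ₀ : SSEP.HasBoundedFourthDeriv fun u => (ρ₀ u : ℝ)) :
    (3 ≤ d → ∃ C : ℝ, ∀ n : ℕ, 1 ≤ n → ∀ P : Measure (SSEP.Path d),
      SSEP.IsLaw n (SSEP.initialMeasure ρ₀ n) P →
      ∀ t : ℝ≥0, (t : ℝ) ≤ T → ∀ x : Fin k → SSEP.Site d, Function.Injective x →
        |SSEP.correlation P (fun _ => t) x| ≤ C / (n : ℝ) ^ k) ∧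
    (d = 2 → ∃ C : ℝ, ∀ n : ℕ, 1 ≤ n → ∀ P : Measure (SSEP.Path d),
      SSEP.IsLaw n (SSEP.initialMeasure ρ₀ n) P →
      ∀ t : ℝ≥0, (t : ℝ) ≤ T → ∀ x : Fin k → SSEP.Site d, Function.Injective x →
        |SSEP.correlation P (fun _ => t) x| ≤
          C / (n : ℝ) ^ k * max (Real.log (1 + (n : ℝ) ^ 2 * t) ^ (k - 1))
            (Real.log (1 + (n : ℝ) ^ 2 * t) ^ ((k + 1) / 2))) ∧
    (d = 2 → Even k → ∃ C : ℝ, ∀ n : ℕ, 1 ≤ n → ∀ P : Measure (SSEP.Path d),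
      SSEP.IsLaw n (SSEP.initialMeasure ρ₀ n) P →
      ∀ t : ℝ≥0, (t : ℝ) ≤ T → ∀ x : Fin k → SSEP.Site d, Function.Injective x →
        |SSEP.correlation P (fun _ => t) x| ≤
          C / (n : ℝ) ^ k * Real.log (1 + (n : ℝ) ^ 2 * t) ^ (k / 2)) ∧
    (d = 2 → Odd k → ∃ C : ℝ, ∀ n : ℕ, 1 ≤ n → ∀ P : Measure (SSEP.Path d),
      SSEP.IsLaw n (SSEP.initialMeasure ρ₀ n) P →
      ∀ t : ℝ≥0, (t : ℝ) ≤ T → ∀ x : Fin k → SSEP.Site d, Function.Injective x →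
        |SSEP.correlation P (fun _ => t) x| ≤
          C / (n : ℝ) ^ k * Real.log (1 + (n : ℝ) ^ 2 * t) ^ ((k - 1) / 2) *
            Real.log (1 + Real.log (1 + (n : ℝ) ^ 2 * t))) := by
  have hlog : ∀ y : ℝ, 0 ≤ y → 0 ≤ Real.log (1 + y) := fun y hy =>
    Real.log_nonneg (by linarith)
  have htwo : d = 2 → ∃ C : ℝ, 0 ≤ C ∧ ∀ n : ℕ, 1 ≤ n → ∀ P : Measure (SSEP.Path d),
      SSEP.IsLaw n (SSEP.initialMeasure ρ₀ n) P →
      ∀ t : ℝ≥0, ∀ x : Fin k → SSEP.Site d, Function.Injective x →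
        |SSEP.correlation P (fun _ => t) x| ≤ C / (n : ℝ) ^ k *
          (Real.log (1 + (n : ℝ) ^ 2 * t) ^ (k / 2) *
            Real.log (1 + Real.log (1 + (n : ℝ) ^ 2 * t)) ^ (k % 2)) := by
    rintro rfl
    obtain ⟨C₀, hC₀, hpot⟩ := SSEP.potentialBound_two (Fin k)
    exact SSEP.correlation_le hρ₀ hC₀ (α := fun N => Real.log (1 + N))
      (β := fun N => Real.log (1 + Real.log (1 + N))) (fun N hN => hlog N hN)
      (fun N hN => hlog _ (hlog N hN)) (fun N hN => SSEP.log_one_add_sq_le (hlog N hN)) hpot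
  refine ⟨fun hd => ?_, fun hd => ?_, fun hd hk2 => ?_, fun hd hk2 => ?_⟩
  · obtain ⟨C₀, hC₀, hpot⟩ := SSEP.potentialBound_three (Fin k) hd
    obtain ⟨C, -, hC⟩ := SSEP.correlation_le hρ₀ hC₀ (α := fun _ => 1) (β := fun _ => 1)
      (fun _ _ => zero_le_one) (fun _ _ => zero_le_one) (fun _ _ => by norm_num) hpot
    exact ⟨C, fun n hn P hP t _ x hx => by simpa using hC n hn P hP t x hx⟩
  · obtain ⟨C, hC0, hC⟩ := htwo hd
    refine ⟨C, fun n hn P hP t _ x hx => (hC n hn P hP t x hx).trans ?_⟩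
    -- The second entry of the maximum suffices: `log(1+ℓ) ≤ ℓ` turns `ℓ^{k/2} log(1+ℓ)^{k%2}` into
    -- `ℓ^{⌈k/2⌉}`.
    refine mul_le_mul_of_nonneg_left (le_max_of_le_right ?_) (by positivity)
    have hl : 0 ≤ Real.log (1 + (n : ℝ) ^ 2 * t) := hlog _ (by positivity)
    have hle : Real.log (1 + Real.log (1 + (n : ℝ) ^ 2 * t)) ≤ Real.log (1 + (n : ℝ) ^ 2 * t) := by
      have := Real.log_le_sub_one_of_pos (by linarith : 0 < 1 + Real.log (1 + (n : ℝ) ^ 2 * t))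
      linarith
    have he : (k + 1) / 2 = k / 2 + k % 2 := by omega
    rw [he, pow_add]
    exact mul_le_mul_of_nonneg_left (pow_le_pow_left₀ (hlog _ hl) hle _) (by positivity)
  · obtain ⟨C, -, hC⟩ := htwo hd
    refine ⟨C, fun n hn P hP t _ x hx => (hC n hn P hP t x hx).trans (le_of_eq ?_)⟩
    rw [Nat.even_iff.1 hk2, pow_zero, mul_one]
  · obtain ⟨C, -, hC⟩ := htwo hd
    refine ⟨C, fun n hn P hP t _ x hx => (hC n hn P hP t x hx).trans (le_of_eq ?_)⟩
    have h1 := Nat.odd_iff.1 hk2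
    have h2 : (k - 1) / 2 = k / 2 := by omega
    rw [h1, h2, pow_one, mul_assoc]
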